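/- Let $\varepsilon_0,\varepsilon_1\in\{1,-1\}$, let $M$ be a smooth manifold of dimension $2n+1$, and let $(\varphi,\xi,\eta,g)$ be a (para)contact metric structure on $M$: $\varphi$ is a $(1,1)$-tensor field, $\xi$ a vector field, $\eta$ a 1-form and $g$ a Riemannian or pseudo-Riemannian metric such that, for all vector fields $X,Y$, $$\varphi^2X=\varepsilon_1(X-\eta(X)\xi),\qquad \eta(\xi)=1,\qquad g(\varphi X,\varphi Y)=-\varepsilon_1\bigl(g(X,Y)-\varepsilon_0\,\eta(X)\eta(Y)\bigr),$$ and $g(X,\varphi Y)=d\eta(X,Y)$, where $d\eta(X,Y)=\tfrac12\bigl(X\eta(Y)-Y\eta(X)-\eta([X,Y])\bigr)$. Let $\nabla$ be the Levi-Civita connection of $g$, $R(X,Y)=[\nabla_X,\nabla_Y]-\nabla_{[X,Y]}$ its curvature operator, $h=\tfrac12\mathcal L_\xi\varphi$, and $$Ric(X,Y)=\operatorname{Tr}\{Z\mapsto R(Z,X)Y\},\qquad Ric^*(X,Y)=\operatorname{Tr}\{Z\mapsto R(\varphi Z,X)\varphi Y\}.$$ Then, for all vector fields $X,Y$ on $M$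 and every orthonormal frame $(E_i)$ with $\varepsilon_i=g(E_i,E_i)$, $$Ric(\varphi X,\varphi Y)-\varepsilon_1Ric(X,Y)+Ric^*(X,Y)+Ric^*(Y,X)$$ $$=-\sum_{i=1}^{2n+1}\varepsilon_i\,g\bigl((\nabla_{E_i}\varphi)X,(\nabla_{E_i}\varphi)Y\bigr)+(4n-1)\varepsilon_0\,g(X,Y)+\eta(X)\eta(Y)-2\varepsilon_1\,g(X,hY)-\varepsilon_0\,g(hX,hY).$$ -/

import Mathlib

open Bundle FiberBundle VectorField
open scoped Manifold ContDiff

noncomputable section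

namespace ParaContact

/-- The model vector space of a manifold of dimension `2n+1`. -/
abbrev Model (n : ℕ) : Type := EuclideanSpace ℝ (Fin (2 * n + 1))

variable (n : ℕ) (M : Type*) [TopologicalSpace M] [ChartedSpace (Model n) M]

/-- (Rough) vector fields on `M`. -/
abbrev VF : Type _ := ∀ p : M, TangentSpace (𝓡 (2 * n + 1)) p

variable [IsManifold (𝓡 (2 * n + 1)) ∞ M]

variable {n M} in
/-- Smoothness of a vector field. -/
def SmoothVF (X : VF n M) : Prop := ContMDiff (𝓡 (2 * n + 1)) (𝓡 (2 * n + 1)).tangent ∞ (T% X)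

/-- A smooth pseudo-Riemannian metric (of any signature, the Riemannian one included). -/
structure PseudoMetric where
  /-- the scalar product on the tangent spaces -/
  val (p : M) : TangentSpace (𝓡 (2 * n + 1)) p →L[ℝ] TangentSpace (𝓡 (2 * n + 1)) p →L[ℝ] ℝ
  symm (p : M) (u v : TangentSpace (𝓡 (2 * n + 1)) p) : val p u v = val p v u
  nondegenerate (p : M) (u : TangentSpace (𝓡 (2 * n + 1)) p) (hu : ∀ v, val p u v = 0) : u = 0
  smooth : ContMDiff (𝓡 (2 * n + 1)) ((𝓡 (2 * n + 1)).prod 𝓘(ℝ, Model n →L[ℝ] Model n →L[ℝ] ℝ)) ∞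
    (fun p ↦ TotalSpace.mk' (Model n →L[ℝ] Model n →L[ℝ] ℝ)
      (E := fun p : M ↦ TangentSpace (𝓡 (2 * n + 1)) p →L[ℝ] TangentSpace (𝓡 (2 * n + 1)) p →L[ℝ] ℝ) p (val p))

/-- An almost (para)contact metric structure `(φ, ξ, η, g)` with signs `ε₀ = ±1`, `ε₁ = ±1`:
almost contact metric when `ε₁ = -1`, almost paracontact metric when `ε₁ = 1`. -/
structure AlmostParaContactMetric (ε₀ ε₁ : ℝ) where
  sign₀ : ε₀ = 1 ∨ ε₀ = -1
  sign₁ : ε₁ = 1 ∨ ε₁ = -1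
  /-- the metric -/
  g : PseudoMetric n M
  /-- the `(1,1)`-tensor field -/
  φ (p : M) : TangentSpace (𝓡 (2 * n + 1)) p →L[ℝ] TangentSpace (𝓡 (2 * n + 1)) p
  /-- the characteristic vector field -/
  ξ : VF n M
  /-- the 1-form -/
  η (p : M) : TangentSpace (𝓡 (2 * n + 1)) p →L[ℝ] ℝ
  smooth_φ : ContMDiff (𝓡 (2 * n + 1)) ((𝓡 (2 * n + 1)).prod 𝓘(ℝ, Model n →L[ℝ] Model n)) ∞
    (fun p ↦ TotalSpace.mk' (Model n →L[ℝ] Model n)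
      (E := fun p : M ↦ TangentSpace (𝓡 (2 * n + 1)) p →L[ℝ] TangentSpace (𝓡 (2 * n + 1)) p) p (φ p))
  smooth_ξ : SmoothVF ξ
  smooth_η : ContMDiff (𝓡 (2 * n + 1)) ((𝓡 (2 * n + 1)).prod 𝓘(ℝ, Model n →L[ℝ] ℝ)) ∞
    (fun p ↦ TotalSpace.mk' (Model n →L[ℝ] ℝ)
      (E := fun p : M ↦ TangentSpace (𝓡 (2 * n + 1)) p →L[ℝ] ℝ) p (η p))
  φ_sq (p : M) (u : TangentSpace (𝓡 (2 * n + 1)) p) : φ p (φ p u) = ε₁ • (u - η p u • ξ p)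
  η_ξ (p : M) : η p (ξ p) = 1
  g_φ (p : M) (u v : TangentSpace (𝓡 (2 * n + 1)) p) :
    g.val p (φ p u) (φ p v) = -ε₁ * (g.val p u v - ε₀ * (η p u * η p v))

variable {n M}

/-- The exterior derivative of a 1-form, evaluated on vector fields, in the convention
`2 dη(X,Y) = X(η(Y)) - Y(η(X)) - η([X,Y])`. -/
def extDer (η : ∀ p : M, TangentSpace (𝓡 (2 * n + 1)) p →L[ℝ] ℝ) (X Y : VF n M) (p : M) : ℝ :=
  (1 / 2) * (mvfderiv (𝓡 (2 * n + 1)) (fun q ↦ η q (Y q)) p (X p) - mvfderiv (𝓡 (2 * n + 1)) (fun q ↦ η q (X q)) p (Y p)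
    - η p (mlieBracket (𝓡 (2 * n + 1)) X Y p))

namespace AlmostParaContactMetric

variable {ε₀ ε₁ : ℝ} (S : AlmostParaContactMetric n M ε₀ ε₁)

/-- The field of endomorphisms `φ` applied to a vector field. -/
def φF (X : VF n M) : VF n M := fun p ↦ S.φ p (X p)

/-- A (para)contact metric structure: the fundamental form `Φ(X,Y) = g(X,φY)` is `dη`. -/
def IsParaContact : Prop :=
  ∀ X Y : VF n M, SmoothVF X → SmoothVF Y → ∀ p,
    S.g.val p (X p) (S.φ p (Y p)) = extDer S.η X Y p

/-- The operator `h = ½ L_ξ φ`, that is `hX = ½ ([ξ, φX] - φ[ξ, X])`. -/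
def h (X : VF n M) : VF n M := fun p ↦
  (1 / 2 : ℝ) • (mlieBracket (𝓡 (2 * n + 1)) S.ξ (S.φF X) p
    - S.φ p (mlieBracket (𝓡 (2 * n + 1)) S.ξ X p))

end AlmostParaContactMetric

variable (n M) in
/-- Affine connections on `M`. -/
abbrev Connection : Type _ :=
  CovariantDerivative (𝓡 (2 * n + 1)) (Model n) (TangentSpace (𝓡 (2 * n + 1)) : M → Type _)

/-- `D` is the Levi-Civita connection of `g`: the smooth affine connection that is torsion-free
and for which `X (g(Y,Z)) = g(D_X Y, Z) + g(Y, D_X Z)`. -/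
structure IsLeviCivita (g : PseudoMetric n M) (D : Connection n M) : Prop where
  smooth : CovariantDerivative.ContMDiffCovariantDerivative D ∞
  torsion_free : D.torsion = 0
  metric : ∀ Y Z : VF n M, ∀ p, MDifferentiableAt (𝓡 (2 * n + 1)) (𝓡 (2 * n + 1)).tangent (T% Y) p → MDifferentiableAt (𝓡 (2 * n + 1)) (𝓡 (2 * n + 1)).tangent (T% Z) p → ∀ u : TangentSpace (𝓡 (2 * n + 1)) p,
    mvfderiv (𝓡 (2 * n + 1)) (fun q ↦ g.val q (Y q) (Z q)) p u = g.val p (D Y p u) (Z p) + g.val p (Y p) (D Z p u)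

/-- The covariant derivative `D_X Y` of vector fields. -/
def cov (D : Connection n M) (X Y : VF n M) : VF n M := fun p ↦ D Y p (X p)

/-- The curvature operator `R(X,Y)Z = D_X D_Y Z - D_Y D_X Z - D_[X,Y] Z`. -/
def curv (D : Connection n M) (X Y Z : VF n M) : VF n M := fun p ↦
  cov D X (cov D Y Z) p - cov D Y (cov D X Z) p
    - cov D (mlieBracket (𝓡 (2 * n + 1)) X Y) Z p

/-- The trace at `p` of an endomorphism `A` of the tangent bundle that is given by its action on
vector fields, computed in a basis of the tangent space at `p` whose vectors are extended to
vector fields that are smooth near `p`. -/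
def traceAt (A : VF n M → VF n M) (p : M) : ℝ :=
  haveI : Module.Finite ℝ (TangentSpace (𝓡 (2 * n + 1)) p) :=
    inferInstanceAs (Module.Finite ℝ (Model n))
  let b := Module.finBasis ℝ (TangentSpace (𝓡 (2 * n + 1)) p)
  ∑ i, b.coord i (A (extend (Model n) (b i)) p)

/-- The Ricci tensor `Ric(X,Y) = Tr {Z ↦ R(Z,X)Y}`. -/
def Ric (D : Connection n M) (X Y : VF n M) (p : M) : ℝ :=
  traceAt (fun Z ↦ curv D Z X Y) p

namespace AlmostParaContactMetric

variable {ε₀ ε₁ : ℝ} (S : AlmostParaContactMetric n M ε₀ ε₁)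

/-- The *-Ricci tensor `Ric*(X,Y) = Tr {Z ↦ R(φZ,X)φY}`. -/
def RicStar (D : Connection n M) (X Y : VF n M) (p : M) : ℝ :=
  traceAt (fun Z ↦ curv D (S.φF Z) X (S.φF Y)) p

/-- The derivative `(D_u φ)X = D_u (φX) - φ (D_u X)` in the direction of a tangent vector `u`. -/
def covφ (D : Connection n M) {p : M} (u : TangentSpace (𝓡 (2 * n + 1)) p) (X : VF n M) : TangentSpace (𝓡 (2 * n + 1)) p :=
  D (S.φF X) p u - S.φ p (D X p u)

end AlmostParaContactMetric

/-- `(E_i)` is an orthonormal frame at `p`: `g(E_i,E_i) = ±1` and `g(E_i,E_j) = 0` for `i ≠ j`. -/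
def IsOrthonormalFrameAt (g : PseudoMetric n M) (p : M) (E : Fin (2 * n + 1) → TangentSpace (𝓡 (2 * n + 1)) p) : Prop :=
  (∀ i, g.val p (E i) (E i) = 1 ∨ g.val p (E i) (E i) = -1) ∧
    ∀ i j, i ≠ j → g.val p (E i) (E j) = 0

end ParaContact

end

/-! Write A = ∇ξ and Φ(X,Y) = g(X,φY). The identity comes from evaluating the rough Laplacian of φ,
i.e. the contraction ∑ g(Y, (∇²_{b_i,c_i}φ)φZ) over dual frames, in two ways, and symmetrizing in Y
and Z.

On one side, Φ = dη is closed, so `sum_hessPhi_diag` rewrites the Laplacian through contractions ∑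
g(c_i, (∇²_{b_i,Y}φ)Z). Exchanging the two derivatives by the Ricci identity (`sum_hessPhi_left`)
leaves the derivative of the divergence of φ, a Ricci term and a *-Ricci term. The divergence is
explicit (`trace_dphi`), so its derivative involves only A.

On the other side, differentiating φ² = ε₁(1 - η⊗ξ) twice (`hessPhi_phi`) expresses the symmetrized
Laplacian by products of two first derivatives of φ, products of two values of A, and the Laplacian
of ξ (`sum_hessPhi_diag_phi`). The last contains Ric(·,ξ), and so does the first side through
Ric(Y,φ²Z); these terms cancel and never have to be computed.

What remains is quadratic in A and is expressed by h. The contact condition says that the adjoint of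
A is A + 2ε₀φ, and together with closedness it yields Aφ + φA = -2ε₀φ², ∇_ξφ = 0 and h = φA + ε₀φ².
-/

noncomputable section

namespace ParaContact

variable {n : ℕ} {M : Type*} [TopologicalSpace M] [ChartedSpace (Model n) M]
  [IsManifold (𝓡 (2 * n + 1)) ∞ M]

/-! ### Smooth vector fields and their extension from a point -/

variable (n M) in
/-- Smooth vector fields, bundled. -/
abbrev SVF : Type _ :=
  Cₛ^∞⟮𝓡 (2 * n + 1); Model n, (TangentSpace (𝓡 (2 * n + 1)) : M → Type _)⟯

/-- The product of a vector field with a smooth function. -/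
def SVF.fsmul (f : M → ℝ) (hf : ContMDiff (𝓡 (2 * n + 1)) 𝓘(ℝ, ℝ) ∞ f) (X : SVF n M) : SVF n M :=
  ⟨f • ⇑X, hf.smul_section X.contMDiff⟩

lemma SVF.mdifferentiableAt (X : SVF n M) (p : M) :
    MDifferentiableAt (𝓡 (2 * n + 1)) (𝓡 (2 * n + 1)).tangent (T% (⇑X)) p :=
  ContMDiffSection.mdifferentiableAt X

@[simp] lemma SVF.add_apply (X Y : SVF n M) (p : M) : (X + Y) p = X p + Y p := rfl

@[simp] lemma SVF.sub_apply (X Y : SVF n M) (p : M) : (X - Y) p = X p - Y p := rfl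

@[simp] lemma SVF.neg_apply (X : SVF n M) (p : M) : (-X) p = -X p := rfl

@[simp] lemma SVF.smul_apply (a : ℝ) (X : SVF n M) (p : M) : (a • X) p = a • X p := rfl

lemma PseudoMetric.contMDiff_apply (g : PseudoMetric n M) (X Y : SVF n M) :
    ContMDiff (𝓡 (2 * n + 1)) 𝓘(ℝ, ℝ) ∞ (fun q ↦ g.val q (X q) (Y q)) := by
  have h : ContMDiff (𝓡 (2 * n + 1)) ((𝓡 (2 * n + 1)).prod 𝓘(ℝ, ℝ)) ∞
      (fun m ↦ TotalSpace.mk' ℝ (E := Bundle.Trivial M ℝ) m (g.val m (X m) (Y m))) :=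
    g.smooth.clm_bundle_apply₂ X.contMDiff Y.contMDiff
  exact fun q ↦ (contMDiffAt_section (E := Bundle.Trivial M ℝ) q).1 (h q)

lemma PseudoMetric.mdifferentiableAt_apply (g : PseudoMetric n M) (X Y : SVF n M) (p : M) :
    MDifferentiableAt (𝓡 (2 * n + 1)) 𝓘(ℝ, ℝ) (fun q ↦ g.val q (X q) (Y q)) p :=
  (g.contMDiff_apply X Y p).mdifferentiableAt (by simp)

namespace AlmostParaContactMetric

variable {ε₀ ε₁ : ℝ} (S : AlmostParaContactMetric n M ε₀ ε₁)

/-- `φX` as a smooth vector field. -/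
def phi (X : SVF n M) : SVF n M :=
  ⟨S.φF X, S.smooth_φ.clm_bundle_apply X.contMDiff⟩

/-- The characteristic vector field as a smooth vector field. -/
def xi : SVF n M := ⟨S.ξ, S.smooth_ξ⟩

@[simp] lemma phi_apply (X : SVF n M) (p : M) : S.phi X p = S.φ p (X p) := rfl

@[simp] lemma xi_apply (p : M) : S.xi p = S.ξ p := rfl

lemma coe_phi (X : SVF n M) : ⇑(S.phi X) = S.φF X := rfl

lemma coe_xi : ⇑S.xi = S.ξ := rfl

end AlmostParaContactMetric

/-- Every tangent vector is the value of a smooth vector field that agrees near the base point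
with the extension by a constant in the preferred trivialization. -/
lemma exists_eventuallyEq_extend [T2Space M] {p : M} (v : TangentSpace (𝓡 (2 * n + 1)) p) :
    ∃ X : SVF n M, ∀ᶠ q in nhds p, X q = extend (Model n) v q := by
  obtain ⟨s, hs, hsv⟩ := exists_contMDiffOn_extend (k := ∞) (𝓡 (2 * n + 1)) (Model n) v
  obtain ⟨u, hus, hu, hpu⟩ := mem_nhds_iff.1 hs
  obtain ⟨f, hf, -⟩ := (SmoothBumpFunction.nhds_basis_support (I := 𝓡 (2 * n + 1))
    (hu.mem_nhds hpu)).mem_iff.1 (hu.mem_nhds hpu)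
  refine ⟨⟨⇑f • extend (Model n) v, ContMDiffOn.smul_section_of_tsupport
    f.contMDiff.contMDiffOn hu hf (hsv.mono hus)⟩, ?_⟩
  filter_upwards [f.eventuallyEq_one] with q hq
  change f q • extend (Model n) v q = _
  rw [hq, Pi.one_apply, one_smul]

lemma exists_apply_eq [T2Space M] {p : M} (v : TangentSpace (𝓡 (2 * n + 1)) p) :
    ∃ X : SVF n M, X p = v := by
  obtain ⟨X, hX⟩ := exists_eventuallyEq_extend v
  exact ⟨X, by simpa using hX.self_of_nhds⟩

/-! ### The Levi-Civita connection and the symmetries of its curvature -/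

namespace IsLeviCivita

variable {g : PseudoMetric n M} {D : Connection n M}

/-- The covariant derivative of smooth vector fields, as a smooth vector field. -/
def nab (hD : IsLeviCivita g D) (X Y : SVF n M) : SVF n M :=
  ⟨cov D X Y, by
    have h := hD.smooth.contMDiff.contMDiff (σ := Y) (by simpa using! Y.contMDiff.contMDiffOn)
    exact (contMDiffOn_univ.1 h).clm_bundle_apply X.contMDiff⟩

variable (hD : IsLeviCivita g D)

@[simp] lemma nab_apply (X Y : SVF n M) (p : M) : hD.nab X Y p = D Y p (X p) := rfl

lemma coe_nab (X Y : SVF n M) : ⇑(hD.nab X Y) = cov D X Y := rfl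

end IsLeviCivita

section Connection

variable (D : Connection n M)

@[simp] lemma connection_add (X Y : SVF n M) (p : M) : D ⇑(X + Y) p = D X p + D Y p :=
  D.isCovariantDerivativeOnUniv.add (X.mdifferentiableAt p) (Y.mdifferentiableAt p)

@[simp] lemma connection_smul (a : ℝ) (X : SVF n M) (p : M) : D ⇑(a • X) p = a • D X p :=
  D.isCovariantDerivativeOnUniv.smul_const a (X.mdifferentiableAt p)

@[simp] lemma connection_neg (X : SVF n M) (p : M) : D ⇑(-X) p = -D X p := by
  rw [← neg_one_smul ℝ X, connection_smul, neg_one_smul]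

@[simp] lemma connection_sub (X Y : SVF n M) (p : M) : D ⇑(X - Y) p = D X p - D Y p := by
  rw [sub_eq_add_neg, connection_add, connection_neg, sub_eq_add_neg]

lemma connection_fsmul (f : M → ℝ) (hf : ContMDiff (𝓡 (2 * n + 1)) 𝓘(ℝ, ℝ) ∞ f) (X : SVF n M)
    (p : M) (u : TangentSpace (𝓡 (2 * n + 1)) p) :
    D ⇑(X.fsmul f hf) p u = f p • D X p u + mvfderiv (𝓡 (2 * n + 1)) f p u • X p := by
  have h : D ⇑(X.fsmul f hf) p = _ := D.isCovariantDerivativeOnUniv.leibniz (X.mdifferentiableAt p)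
    ((hf p).mdifferentiableAt (by simp))
  rw [h]
  rfl

end Connection

namespace IsLeviCivita

variable {g : PseudoMetric n M} {D : Connection n M} (hD : IsLeviCivita g D)

include hD

lemma mvfderiv_metric (X Y : SVF n M) (p : M) (u : TangentSpace (𝓡 (2 * n + 1)) p) :
    mvfderiv (𝓡 (2 * n + 1)) (fun q ↦ g.val q (X q) (Y q)) p u
      = g.val p (D X p u) (Y p) + g.val p (X p) (D Y p u) :=
  hD.metric X Y p (X.mdifferentiableAt p) (Y.mdifferentiableAt p) u

lemma mlieBracket_apply (X Y : SVF n M) (p : M) :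
    mlieBracket (𝓡 (2 * n + 1)) X Y p = D Y p (X p) - D X p (Y p) :=
  ((CovariantDerivative.torsion_eq_zero_iff D).1 hD.torsion_free (X.mdifferentiableAt p)
    (Y.mdifferentiableAt p)).symm

lemma mlieBracket_eq (X Y : SVF n M) :
    mlieBracket (𝓡 (2 * n + 1)) X Y = ⇑(hD.nab X Y - hD.nab Y X) := by
  funext p
  rw [hD.mlieBracket_apply]
  rfl

omit hD in
/-- The curvature operator applied to smooth vector fields, as a smooth vector field. -/
def curvS (hD : IsLeviCivita g D) (X Y Z : SVF n M) : SVF n M :=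
  hD.nab X (hD.nab Y Z) - hD.nab Y (hD.nab X Z) - hD.nab (hD.nab X Y - hD.nab Y X) Z

lemma curv_eq (X Y Z : SVF n M) : curv D X Y Z = ⇑(hD.curvS X Y Z) := by
  funext p
  simp only [curv, hD.mlieBracket_eq, ← hD.coe_nab]
  rfl

lemma curvS_swap (X Y Z : SVF n M) (p : M) : hD.curvS X Y Z p = -hD.curvS Y X Z p := by
  simp only [curvS, SVF.sub_apply, nab_apply, map_sub]
  abel

omit hD in
lemma jacobi (X Y Z : SVF n M) (p : M) :
    mlieBracket (𝓡 (2 * n + 1)) X (mlieBracket (𝓡 (2 * n + 1)) Y Z) p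
      = mlieBracket (𝓡 (2 * n + 1)) (mlieBracket (𝓡 (2 * n + 1)) X Y) Z p
        + mlieBracket (𝓡 (2 * n + 1)) Y (mlieBracket (𝓡 (2 * n + 1)) X Z) p := by
  have : IsManifold (𝓡 (2 * n + 1)) (minSmoothness ℝ 3) M := by
    rw [minSmoothness_of_isRCLikeNormedField]
    infer_instance
  have h (X : SVF n M) : ContMDiffAt (𝓡 (2 * n + 1)) (𝓡 (2 * n + 1)).tangent
      (minSmoothness ℝ 2) (T% (⇑X)) p :=
    (X.contMDiff p).of_le (by
      rw [minSmoothness_of_isRCLikeNormedField]; exact ENat.LEInfty.out)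
  exact leibniz_identity_mlieBracket_apply (h X) (h Y) (h Z)

/-- With zero torsion every bracket is a difference of covariant derivatives, and the Jacobi
identity expands to exactly this cyclic sum. -/
lemma bianchi (X Y Z : SVF n M) (p : M) :
    hD.curvS X Y Z p + hD.curvS Y Z X p + hD.curvS Z X Y p = 0 := by
  have h := jacobi X Y Z p
  simp only [hD.mlieBracket_eq, SVF.sub_apply, nab_apply, map_sub, connection_sub,
    _root_.sub_apply] at h
  simp only [curvS, SVF.sub_apply, nab_apply, map_sub]
  rw [← sub_eq_zero] at h
  rw [← h]
  abel

end IsLeviCivita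

@[simp] lemma SVF.fsmul_apply (f : M → ℝ) (hf : ContMDiff (𝓡 (2 * n + 1)) 𝓘(ℝ, ℝ) ∞ f)
    (X : SVF n M) (p : M) : X.fsmul f hf p = f p • X p := rfl

lemma PseudoMetric.eq_of_forall (g : PseudoMetric n M) {p : M}
    {u v : TangentSpace (𝓡 (2 * n + 1)) p} (h : ∀ w, g.val p u w = g.val p v w) : u = v := by
  rw [← sub_eq_zero]
  exact g.nondegenerate p _ fun w ↦ by simp [h w]

lemma exists_ne_zero [T2Space M] (p : M) : ∃ X : SVF n M, X p ≠ 0 := by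
  have : Nontrivial (TangentSpace (𝓡 (2 * n + 1)) p) := inferInstanceAs (Nontrivial (Model n))
  obtain ⟨v, hv⟩ := exists_ne (0 : TangentSpace (𝓡 (2 * n + 1)) p)
  obtain ⟨X, rfl⟩ := exists_apply_eq v
  exact ⟨X, hv⟩

/-- An operator on smooth vector fields with values in a vector space that is linear over the reals
and vanishes on fields vanishing at `p` is a linear function of the value at `p`. -/
lemma exists_linearMap [T2Space M] {p : M} {F : Type*} [AddCommGroup F] [Module ℝ F]
    (A : SVF n M → F) (hadd : ∀ X Y, A (X + Y) = A X + A Y)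
    (hsmul : ∀ (a : ℝ) X, A (a • X) = a • A X) (h : ∀ X, X p = 0 → A X = 0) :
    ∃ L : TangentSpace (𝓡 (2 * n + 1)) p →ₗ[ℝ] F, ∀ X, A X = L (X p) := by
  have hc (X Y : SVF n M) (hXY : X p = Y p) : A X = A Y := by
    have h' := h (X + (-1 : ℝ) • Y) (by simp [hXY])
    rw [hadd, hsmul] at h'
    rw [← sub_eq_zero, ← h']
    module
  choose e he using fun v ↦ exists_apply_eq (M := M) (n := n) (p := p) v
  refine ⟨⟨⟨fun v ↦ A (e v), fun u v ↦ ?_⟩, fun a v ↦ ?_⟩, fun X ↦ hc _ _ (he _).symm⟩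
  · rw [← hadd]
    exact hc _ _ (by simp [he])
  · simp only [RingHom.id_apply]
    rw [← hsmul]
    exact hc _ _ (by simp [he])

namespace IsLeviCivita

variable {g : PseudoMetric n M} {D : Connection n M} (hD : IsLeviCivita g D)

lemma nab_fsmul_left (f : M → ℝ) (hf : ContMDiff (𝓡 (2 * n + 1)) 𝓘(ℝ, ℝ) ∞ f) (X Y : SVF n M) :
    hD.nab (X.fsmul f hf) Y = (hD.nab X Y).fsmul f hf := by
  ext p
  simp

/-- The derivative of `f` along `X` enters as a separate smooth function `f'`, so that its product
with `Y` is again a bundled smooth field and can be differentiated once more. -/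
lemma nab_fsmul_right (f f' : M → ℝ) (hf : ContMDiff (𝓡 (2 * n + 1)) 𝓘(ℝ, ℝ) ∞ f)
    (hf' : ContMDiff (𝓡 (2 * n + 1)) 𝓘(ℝ, ℝ) ∞ f') (X Y : SVF n M)
    (h : ∀ q, mvfderiv (𝓡 (2 * n + 1)) f q (X q) = f' q) :
    hD.nab X (Y.fsmul f hf) = (hD.nab X Y).fsmul f hf + Y.fsmul f' hf' := by
  ext p
  simp [connection_fsmul, h]

lemma curvS_fsmul_left (f f' : M → ℝ) (hf : ContMDiff (𝓡 (2 * n + 1)) 𝓘(ℝ, ℝ) ∞ f)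
    (hf' : ContMDiff (𝓡 (2 * n + 1)) 𝓘(ℝ, ℝ) ∞ f') (X Y Z : SVF n M)
    (h : ∀ q, mvfderiv (𝓡 (2 * n + 1)) f q (Y q) = f' q) (p : M) :
    hD.curvS (X.fsmul f hf) Y Z p = f p • hD.curvS X Y Z p := by
  simp only [curvS, SVF.sub_apply, hD.nab_fsmul_left, hD.nab_fsmul_right f f' hf hf' _ _ h,
    SVF.add_apply, SVF.fsmul_apply, nab_apply, map_sub, map_add, map_smul]
  module

lemma curvS_fsmul_right (f fX fY : M → ℝ) (hf : ContMDiff (𝓡 (2 * n + 1)) 𝓘(ℝ, ℝ) ∞ f)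
    (hfX : ContMDiff (𝓡 (2 * n + 1)) 𝓘(ℝ, ℝ) ∞ fX) (hfY : ContMDiff (𝓡 (2 * n + 1)) 𝓘(ℝ, ℝ) ∞ fY)
    (X Y Z : SVF n M)
    (hX : ∀ q, mvfderiv (𝓡 (2 * n + 1)) f q (X q) = fX q)
    (hY : ∀ q, mvfderiv (𝓡 (2 * n + 1)) f q (Y q) = fY q) (p : M) :
    hD.curvS X Y (Z.fsmul f hf) p = f p • hD.curvS X Y Z p +
      (mvfderiv (𝓡 (2 * n + 1)) fY p (X p) - mvfderiv (𝓡 (2 * n + 1)) fX p (Y p)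
        - mvfderiv (𝓡 (2 * n + 1)) f p (D Y p (X p) - D X p (Y p))) • Z p := by
  simp only [curvS, SVF.sub_apply, hD.nab_fsmul_right f fX hf hfX _ _ hX,
    hD.nab_fsmul_right f fY hf hfY _ _ hY, nab_apply, connection_add, _root_.add_apply,
    connection_fsmul, hX, hY, map_sub]
  module

-- This is [X,Y]f = XYf - YXf, read off from the Bianchi identity. The curvature is linear over
-- functions in its first two slots, whereas in the third slot the factor f produces the defect of
-- this formula times Z. Comparing Bianchi for fZ with f times Bianchi for Z kills that defect
-- wherever Z ≠ 0.
include hD in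
lemma mvfderiv_commutator [T2Space M] (f fX fY : M → ℝ)
    (hf : ContMDiff (𝓡 (2 * n + 1)) 𝓘(ℝ, ℝ) ∞ f)
    (hfX : ContMDiff (𝓡 (2 * n + 1)) 𝓘(ℝ, ℝ) ∞ fX) (hfY : ContMDiff (𝓡 (2 * n + 1)) 𝓘(ℝ, ℝ) ∞ fY)
    (X Y : SVF n M)
    (hX : ∀ q, mvfderiv (𝓡 (2 * n + 1)) f q (X q) = fX q)
    (hY : ∀ q, mvfderiv (𝓡 (2 * n + 1)) f q (Y q) = fY q) (p : M) :
    mvfderiv (𝓡 (2 * n + 1)) fY p (X p) - mvfderiv (𝓡 (2 * n + 1)) fX p (Y p)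
      = mvfderiv (𝓡 (2 * n + 1)) f p (D Y p (X p) - D X p (Y p)) := by
  obtain ⟨Z, hZ⟩ := exists_ne_zero (n := n) p
  have h1 := hD.bianchi X Y (Z.fsmul f hf) p
  have h2 := hD.bianchi X Y Z p
  rw [hD.curvS_fsmul_right f fX fY hf hfX hfY _ _ _ hX hY,
    hD.curvS_swap Y, hD.curvS_fsmul_left f fY hf hfY _ _ _ hY,
    hD.curvS_fsmul_left f fX hf hfX _ _ _ hX] at h1
  rw [hD.curvS_swap Y] at h2
  rw [← sub_eq_zero]
  refine (smul_eq_zero.1 ?_).resolve_right hZ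
  linear_combination (norm := module) h1 - f p • h2

/-- Second derivatives of the function g(Z,W) commute up to the bracket; expanding both orders by
metricity leaves only the curvature terms. -/
lemma metric_curvS_skew [T2Space M] (X Y Z W : SVF n M) (p : M) :
    g.val p (hD.curvS X Y Z p) (W p) = -g.val p (Z p) (hD.curvS X Y W p) := by
  have h := hD.mvfderiv_commutator (fun q ↦ g.val q (Z q) (W q))
    (fun q ↦ g.val q (hD.nab X Z q) (W q) + g.val q (Z q) (hD.nab X W q))
    (fun q ↦ g.val q (hD.nab Y Z q) (W q) + g.val q (Z q) (hD.nab Y W q))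
    (g.contMDiff_apply _ _) ((g.contMDiff_apply _ _).add (g.contMDiff_apply _ _))
    ((g.contMDiff_apply _ _).add (g.contMDiff_apply _ _)) X Y
    (fun q ↦ hD.mvfderiv_metric _ _ _ _) (fun q ↦ hD.mvfderiv_metric _ _ _ _) p
  rw [mvfderiv_fun_add (g.mdifferentiableAt_apply _ _ _) (g.mdifferentiableAt_apply _ _ _),
    mvfderiv_fun_add (g.mdifferentiableAt_apply _ _ _) (g.mdifferentiableAt_apply _ _ _)] at h
  simp only [_root_.add_apply, hD.mvfderiv_metric] at h
  simp only [nab_apply, map_sub, _root_.sub_apply] at h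
  simp only [curvS, SVF.sub_apply, nab_apply, map_sub, _root_.sub_apply]
  linarith

lemma metric_curvS_pair [T2Space M] (X Y Z W : SVF n M) (p : M) :
    g.val p (hD.curvS X Y Z p) (W p) = g.val p (hD.curvS Z W X p) (Y p) := by
  have b (X Y Z W : SVF n M) : g.val p (hD.curvS X Y Z p) (W p)
      + g.val p (hD.curvS Y Z X p) (W p) + g.val p (hD.curvS Z X Y p) (W p) = 0 := by
    rw [← _root_.add_apply, ← _root_.add_apply, ← map_add, ← map_add, hD.bianchi]
    simp
  have s (X Y Z W : SVF n M) : g.val p (hD.curvS X Y Z p) (W p)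
      = -g.val p (hD.curvS Y X Z p) (W p) := by
    rw [hD.curvS_swap]
    simp
  have t (X Y Z W : SVF n M) : g.val p (hD.curvS X Y Z p) (W p)
      = -g.val p (hD.curvS X Y W p) (Z p) := by
    rw [hD.metric_curvS_skew, g.symm]
  -- The classical octahedron argument: four Bianchi identities combined, with the two
  -- skew-symmetries matching their terms.
  linarith [b X Y Z W, b Y Z W X, b Z W X Y, b W X Y Z, s X Y Z W, s Y Z X W, s Z X Y W,
    s Z W X Y, s X W Y Z, s Y W X Z, t X Y Z W, t X Z Y W, t Y Z X W, t Z W X Y, t X W Y Z,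
    t Y W X Z, t Z X Y W, t W X Y Z, t W Y X Z, t Y W Z X, t X Z W Y, t Z W Y X, t W X Z Y,
    t Y Z W X, t Z X W Y, t X Y W Z, s X Y W Z, s Z W Y X, s Z X W Y, s Y Z W X, s W X Z Y]

lemma exists_curvS_linearMap [T2Space M] (Y Z : SVF n M) (p : M) :
    ∃ L : TangentSpace (𝓡 (2 * n + 1)) p →ₗ[ℝ] TangentSpace (𝓡 (2 * n + 1)) p,
      ∀ X, hD.curvS X Y Z p = L (X p) := by
  refine exists_linearMap (fun X ↦ hD.curvS X Y Z p) (fun X X' ↦ ?_) (fun a X ↦ ?_) fun X hX ↦ ?_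
  · simp only [curvS, SVF.sub_apply, nab_apply, map_sub, SVF.add_apply, map_add, connection_add,
      _root_.add_apply]
    have : hD.nab (X + X') Z = hD.nab X Z + hD.nab X' Z := by ext; simp
    simp only [this, connection_add, _root_.add_apply]
    abel
  · have : hD.nab (a • X) Z = a • hD.nab X Z := by ext; simp
    simp only [curvS, SVF.sub_apply, nab_apply, map_sub, SVF.smul_apply, map_smul,
      connection_smul, _root_.smul_apply, this]
    module
  · refine g.nondegenerate p _ fun w ↦ ?_
    obtain ⟨W, rfl⟩ := exists_apply_eq w
    -- Pair symmetry and skewness move `X` to a slot where only its value at `p` is seen.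
    rw [hD.metric_curvS_pair, hD.metric_curvS_skew, hX]
    simp

end IsLeviCivita

/-! ### Pointwise algebra of the structure, and first derivatives of φ and ξ -/

namespace AlmostParaContactMetric

variable {ε₀ ε₁ : ℝ} (S : AlmostParaContactMetric n M ε₀ ε₁)

include S in
lemma sign₀_mul_self : ε₀ * ε₀ = 1 := by
  rcases S.sign₀ with h | h <;> simp [h]

include S in
lemma sign₁_mul_self : ε₁ * ε₁ = 1 := by
  rcases S.sign₁ with h | h <;> simp [h]

include S in
lemma sign₁_ne_zero : ε₁ ≠ 0 := by
  rcases S.sign₁ with h | h <;> simp [h]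

lemma ξ_ne_zero (p : M) : S.ξ p ≠ 0 := fun h ↦ by
  simpa [h] using S.η_ξ p

-- Since φ²ξ = 0, applying the formula for φ² to φξ shows φξ = cξ; then c²ξ = φ²ξ = 0 forces c = 0.
@[simp] lemma φ_ξ (p : M) : S.φ p (S.ξ p) = 0 := by
  have h1 : S.φ p (S.φ p (S.ξ p)) = 0 := by simp [S.φ_sq, S.η_ξ]
  have h2 : S.φ p (S.φ p (S.φ p (S.ξ p))) = 0 := by simp [h1]
  rw [S.φ_sq, smul_eq_zero, sub_eq_zero] at h2
  obtain ⟨c, hc⟩ : ∃ c : ℝ, S.φ p (S.ξ p) = c • S.ξ p := ⟨_, h2.resolve_left S.sign₁_ne_zero⟩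
  rw [hc, map_smul, hc, smul_smul, smul_eq_zero] at h1
  rw [hc, mul_self_eq_zero.1 (h1.resolve_right (S.ξ_ne_zero p)), zero_smul]

-- Computing φ³u as φ²(φu) and as φ(φ²u) gives η(φu)ξ = 0.
@[simp] lemma η_φ (p : M) (u : TangentSpace (𝓡 (2 * n + 1)) p) : S.η p (S.φ p u) = 0 := by
  have h1 := S.φ_sq p (S.φ p u)
  have h2 := congrArg (S.φ p) (S.φ_sq p u)
  rw [h1, map_smul, map_sub, map_smul, S.φ_ξ, smul_zero, sub_zero] at h2
  have h3 := smul_right_injective _ S.sign₁_ne_zero h2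
  simpa [S.ξ_ne_zero p] using h3

lemma g_ξ_left (p : M) (u : TangentSpace (𝓡 (2 * n + 1)) p) :
    S.g.val p (S.ξ p) u = ε₀ * S.η p u := by
  have h := S.g_φ p (S.ξ p) u
  rw [S.φ_ξ, S.η_ξ, map_zero, _root_.zero_apply] at h
  have := mul_left_cancel₀ (neg_ne_zero.2 S.sign₁_ne_zero) ((mul_zero _).trans h)
  linarith

lemma g_ξ_right (p : M) (u : TangentSpace (𝓡 (2 * n + 1)) p) :
    S.g.val p u (S.ξ p) = ε₀ * S.η p u := by
  rw [S.g.symm, S.g_ξ_left]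

lemma η_eq (p : M) (u : TangentSpace (𝓡 (2 * n + 1)) p) :
    S.η p u = ε₀ * S.g.val p (S.ξ p) u := by
  rw [S.g_ξ_left, ← mul_assoc, S.sign₀_mul_self, one_mul]

lemma g_φ_left (p : M) (u v : TangentSpace (𝓡 (2 * n + 1)) p) :
    S.g.val p (S.φ p u) v = -S.g.val p u (S.φ p v) := by
  have h := S.g_φ p u (S.φ p v)
  rw [S.φ_sq, map_smul, map_sub, map_smul, S.g_ξ_right, S.η_φ, S.η_φ] at h
  have := mul_left_cancel₀ S.sign₁_ne_zero (a := ε₁) (b := S.g.val p (S.φ p u) v)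
    (c := -S.g.val p u (S.φ p v)) (by simpa using h)
  exact this

/-- The endomorphism `u ↦ D_u ξ` of the tangent space. -/
def nabXi (D : Connection n M) (p : M) :
    TangentSpace (𝓡 (2 * n + 1)) p →L[ℝ] TangentSpace (𝓡 (2 * n + 1)) p := D S.ξ p

@[simp] lemma connection_xi (D : Connection n M) (p : M) : D ⇑S.xi p = S.nabXi D p := rfl

/-- The endomorphism `u ↦ (D_u φ)Z` of the tangent space. -/
def dphi (D : Connection n M) (Z : SVF n M) (p : M) :
    TangentSpace (𝓡 (2 * n + 1)) p →L[ℝ] TangentSpace (𝓡 (2 * n + 1)) p :=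
  D (S.phi Z) p - (S.φ p).comp (D Z p)

lemma covφ_eq (D : Connection n M) (Z : SVF n M) {p : M}
    (u : TangentSpace (𝓡 (2 * n + 1)) p) : S.covφ D u Z = S.dphi D Z p u := rfl

lemma connection_phi (D : Connection n M) (Z : SVF n M) (p : M)
    (u : TangentSpace (𝓡 (2 * n + 1)) p) :
    D ⇑(S.phi Z) p u = S.dphi D Z p u + S.φ p (D Z p u) := by
  simp [dphi]

variable {S} {D : Connection n M} (hD : IsLeviCivita S.g D)

/-- The vector field `(D_X φ)Z`. -/
def dphiS (X Z : SVF n M) : SVF n M := hD.nab X (S.phi Z) - S.phi (hD.nab X Z)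

@[simp] lemma dphiS_apply (X Z : SVF n M) (p : M) :
    dphiS hD X Z p = S.dphi D Z p (X p) := rfl

/-- The second covariant derivative `D_X D_Y ξ - D_{D_X Y} ξ`. -/
def hessXi (X Y : SVF n M) : SVF n M :=
  hD.nab X (hD.nab Y S.xi) - hD.nab (hD.nab X Y) S.xi

/-- The second covariant derivative of `φ` along `W`, `X`, applied to `Z`. -/
def hessPhi (W X Z : SVF n M) : SVF n M :=
  hD.nab W (dphiS hD X Z) - dphiS hD (hD.nab W X) Z - dphiS hD X (hD.nab W Z)

include hD in
lemma mvfderiv_η (Z : SVF n M) (p : M) (u : TangentSpace (𝓡 (2 * n + 1)) p) :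
    mvfderiv (𝓡 (2 * n + 1)) (fun q ↦ S.η q (Z q)) p u
      = ε₀ * S.g.val p (S.nabXi D p u) (Z p) + S.η p (D Z p u) := by
  have : (fun q ↦ S.η q (Z q)) = fun q ↦ S.g.val q ((ε₀ • S.xi) q) (Z q) := by
    funext q
    simp [S.η_eq]
  rw [this, hD.mvfderiv_metric, connection_smul, S.η_eq]
  simp

lemma contMDiff_η (Z : SVF n M) :
    ContMDiff (𝓡 (2 * n + 1)) 𝓘(ℝ, ℝ) ∞ (fun q ↦ S.η q (Z q)) := by
  have : (fun q ↦ S.η q (Z q)) = fun q ↦ S.g.val q ((ε₀ • S.xi) q) (Z q) := by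
    funext q
    simp [S.η_eq]
  rw [this]
  exact S.g.contMDiff_apply _ _

include hD in
lemma η_nabXi (p : M) (u : TangentSpace (𝓡 (2 * n + 1)) p) : S.η p (S.nabXi D p u) = 0 := by
  have h := mvfderiv_η hD S.xi p u
  have h1 : (fun q ↦ S.η q (S.xi q)) = fun _ ↦ 1 := by
    funext q
    simp [S.η_ξ]
  rw [h1, mvfderiv_const, S.connection_xi, S.xi_apply, S.g_ξ_right, ← mul_assoc,
    S.sign₀_mul_self] at h
  simp only [_root_.zero_apply] at h
  linarith

include hD in
lemma dphi_skew (Z W : SVF n M) (p : M) (u : TangentSpace (𝓡 (2 * n + 1)) p) :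
    S.g.val p (S.dphi D Z p u) (W p) = -S.g.val p (Z p) (S.dphi D W p u) := by
  have h : (fun q ↦ S.g.val q (S.phi Z q) (W q)) = fun q ↦ S.g.val q ((-Z) q) (S.phi W q) := by
    funext q
    simp [S.g_φ_left]
  have h1 := hD.mvfderiv_metric (S.phi Z) W p u
  rw [h, hD.mvfderiv_metric] at h1
  simp only [connection_neg, connection_phi, phi_apply, map_add, map_neg, SVF.neg_apply,
    _root_.add_apply, _root_.neg_apply, S.g_φ_left] at h1
  linarith

variable (S) in
lemma phi_phi (Z : SVF n M) :
    S.phi (S.phi Z) = ε₁ • (Z - S.xi.fsmul _ (S.contMDiff_η Z)) := by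
  ext p
  simp [S.φ_sq]

-- The covariant derivative of φ² = ε₁(1 - η⊗ξ).
include hD in
lemma dphi_phi (Z : SVF n M) (p : M) (u : TangentSpace (𝓡 (2 * n + 1)) p) :
    S.dphi D (S.phi Z) p u + S.φ p (S.dphi D Z p u)
      = -ε₁ • ((ε₀ * S.g.val p (S.nabXi D p u) (Z p)) • S.ξ p
          + S.η p (Z p) • S.nabXi D p u) := by
  simp only [dphi, S.phi_phi, connection_smul, connection_sub, _root_.sub_apply,
    ContinuousLinearMap.comp_apply, connection_fsmul, mvfderiv_η hD, map_sub, S.φ_sq,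
    _root_.smul_apply, connection_xi, xi_apply]
  module

lemma dphi_xi (p : M) (u : TangentSpace (𝓡 (2 * n + 1)) p) :
    S.dphi D S.xi p u = -S.φ p (S.nabXi D p u) := by
  have : S.phi S.xi = 0 := by ext p; simp
  simp [dphi, this]

/-! ### First-order consequences of the contact condition -/

section Contact

variable [T2Space M] (hS : S.IsParaContact)

include hD hS

lemma contact (p : M) (u v : TangentSpace (𝓡 (2 * n + 1)) p) :
    2 * S.g.val p u (S.φ p v)
      = ε₀ * (S.g.val p (S.nabXi D p u) v - S.g.val p (S.nabXi D p v) u) := by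
  obtain ⟨X, rfl⟩ := exists_apply_eq u
  obtain ⟨Y, rfl⟩ := exists_apply_eq v
  have h := hS X Y X.contMDiff Y.contMDiff p
  rw [extDer, mvfderiv_η hD, mvfderiv_η hD, hD.mlieBracket_apply, map_sub] at h
  rw [h]
  ring

/-- The contact condition prescribes the skew part of ∇ξ; equivalently, the adjoint of A = ∇ξ is A +
2ε₀φ. -/
lemma g_nabXi (p : M) (u v : TangentSpace (𝓡 (2 * n + 1)) p) :
    S.g.val p (S.nabXi D p u) v
      = S.g.val p u (S.nabXi D p v + (2 * ε₀) • S.φ p v) := by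
  have h := contact hD hS p u v
  rw [map_add, map_smul, smul_eq_mul, S.g.symm p u (S.nabXi D p v)]
  linear_combination (-ε₀) * h + (S.g.val p (S.nabXi D p v) u
    - S.g.val p (S.nabXi D p u) v) * S.sign₀_mul_self

lemma nabXi_ξ (p : M) : S.nabXi D p (S.ξ p) = 0 := by
  refine S.g.nondegenerate p _ fun v ↦ ?_
  rw [g_nabXi hD hS, S.g_ξ_left]
  simp [η_nabXi hD]

lemma dcontact (X Y Z : SVF n M) (p : M) :
    2 * S.g.val p (Y p) (S.dphi D Z p (X p))
      = ε₀ * (S.g.val p (hessXi hD X Y p) (Z p) - S.g.val p (hessXi hD X Z p) (Y p)) := by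
  have h : (fun q ↦ S.g.val q (hD.nab Y S.xi q) (Z q))
      = fun q ↦ S.g.val q (Y q) ((hD.nab Z S.xi + (2 * ε₀) • S.phi Z) q) := by
    funext q
    simp [-map_add, g_nabXi hD hS]
  have h1 := hD.mvfderiv_metric (hD.nab Y S.xi) Z p (X p)
  rw [h, hD.mvfderiv_metric] at h1
  simp only [connection_add, connection_smul, connection_phi, _root_.add_apply, SVF.add_apply,
    SVF.smul_apply, _root_.smul_apply, map_add, map_smul, smul_eq_mul, phi_apply,
    IsLeviCivita.nab_apply, connection_xi] at h1
  have e1 := g_nabXi hD hS p (D Y p (X p)) (Z p)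
  have e2 := g_nabXi hD hS p (Y p) (D Z p (X p))
  simp only [map_add, map_smul, smul_eq_mul] at e1 e2
  simp only [hessXi, SVF.sub_apply, IsLeviCivita.nab_apply, map_sub, _root_.sub_apply,
    connection_xi]
  have s1 := S.g.symm p (Y p) (D (hD.nab Z S.xi) p (X p))
  have s2 := S.g.symm p (Y p) (S.nabXi D p (D Z p (X p)))
  linear_combination ε₀ * (h1 + e1 + e2 - s1 + s2)
    - 2 * S.g.val p (Y p) (S.dphi D Z p (X p)) * S.sign₀_mul_self

/-- The identity dΦ = d(dη) = 0. In the cyclic sum of `dcontact` the second derivatives of ξ pair up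
into curvatures R(·,·)ξ, by skewness into g(ξ, R(·,·)·), and these sum to zero by Bianchi. -/
lemma closed (X Y Z : SVF n M) (p : M) :
    S.g.val p (Y p) (S.dphi D Z p (X p)) + S.g.val p (Z p) (S.dphi D X p (Y p))
      + S.g.val p (X p) (S.dphi D Y p (Z p)) = 0 := by
  have b := congrArg (S.g.val p (S.ξ p)) (hD.bianchi X Y Z p)
  simp only [map_add, map_zero] at b
  have k (X Y Z : SVF n M) : S.g.val p (hessXi hD X Y p) (Z p) - S.g.val p (hessXi hD Y X p) (Z p)
      = -S.g.val p (S.ξ p) (hD.curvS X Y Z p) := by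
    have := hD.metric_curvS_skew X Y S.xi Z p
    simp only [IsLeviCivita.curvS, SVF.sub_apply, map_sub, _root_.sub_apply,
      IsLeviCivita.nab_apply, xi_apply] at this
    simp only [IsLeviCivita.curvS, hessXi, SVF.sub_apply, map_sub, _root_.sub_apply,
      IsLeviCivita.nab_apply]
    linarith
  have d1 := dcontact hD hS X Y Z p
  have d2 := dcontact hD hS Y Z X p
  have d3 := dcontact hD hS Z X Y p
  linear_combination (1 / 2) * (d1 + d2 + d3) + ε₀ / 2 * (k X Y Z + k Y Z X + k Z X Y)
    - ε₀ / 2 * b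

/-- Closedness with ξ in one slot: the other two terms contain (∇φ)ξ = -φA, directly or by skewness.
The right side turns out to be zero in `dphi_ξ`. -/
lemma dphi_ξ_eq (Z : SVF n M) (p : M) :
    S.dphi D Z p (S.ξ p) = -S.φ p (S.nabXi D p (Z p)) - S.nabXi D p (S.φ p (Z p))
      - (2 * ε₀) • S.φ p (S.φ p (Z p)) := by
  refine S.g.eq_of_forall fun w ↦ ?_
  obtain ⟨W, rfl⟩ := exists_apply_eq w
  have h := closed hD hS S.xi W Z p
  have h1 := dphi_skew hD S.xi W p (Z p)
  have h2 := g_nabXi hD hS p (W p) (S.φ p (Z p))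
  have h3 := S.g_φ_left p (S.nabXi D p (W p)) (Z p)
  have h4 := S.g.symm p (S.φ p (S.nabXi D p (W p))) (Z p)
  rw [S.g.symm, S.g.symm p _ (W p)]
  simp only [dphi_xi, map_add, map_neg, map_smul, xi_apply, map_sub, smul_eq_mul,
    _root_.neg_apply] at h h1 h2 h3 ⊢
  have h5 := S.g.symm p (S.φ p (S.nabXi D p (Z p))) (W p)
  linarith

/-- The derivative of φ² in the direction ξ vanishes because Aξ = 0; inserting `dphi_ξ_eq` turns
this into a relation between A and φ. -/
lemma φ_nabXi_φ (p : M) (u : TangentSpace (𝓡 (2 * n + 1)) p) :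
    S.φ p (S.nabXi D p (S.φ p u)) = -ε₁ • S.nabXi D p u - (2 * ε₀ * ε₁) • S.φ p u := by
  obtain ⟨Z, rfl⟩ := exists_apply_eq u
  have h := dphi_phi hD Z p (S.ξ p)
  rw [dphi_ξ_eq hD hS, dphi_ξ_eq hD hS, nabXi_ξ hD hS] at h
  simp only [map_sub, map_neg, map_smul, phi_apply, S.φ_sq, map_zero, η_nabXi hD,
    nabXi_ξ hD hS, smul_zero, _root_.zero_apply, mul_zero, zero_smul, sub_zero, add_zero,
    S.φ_ξ] at h
  linear_combination (norm := module) (-1 / 2 : ℝ) • h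

lemma nabXi_φ (p : M) (u : TangentSpace (𝓡 (2 * n + 1)) p) :
    S.nabXi D p (S.φ p u) = -S.φ p (S.nabXi D p u) - (2 * ε₀) • S.φ p (S.φ p u) := by
  have h := congrArg (S.φ p) (φ_nabXi_φ hD hS p u)
  rw [S.φ_sq, η_nabXi hD, zero_smul, sub_zero] at h
  simp only [map_sub, map_smul] at h
  refine smul_right_injective _ S.sign₁_ne_zero ?_
  simp only
  rw [h]
  module

lemma dphi_ξ (Z : SVF n M) (p : M) : S.dphi D Z p (S.ξ p) = 0 := by
  rw [dphi_ξ_eq hD hS, nabXi_φ hD hS]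
  module

/-- Because ∇_ξφ = 0, the Lie derivative of φ along ξ is φA - Aφ, and Aφ is eliminated by `nabXi_φ`.
-/
lemma h_eq (Z : SVF n M) (p : M) :
    S.h Z p = S.φ p (S.nabXi D p (Z p)) + ε₀ • S.φ p (S.φ p (Z p)) := by
  have h1 := hD.mlieBracket_apply S.xi (S.phi Z) p
  have h2 := hD.mlieBracket_apply S.xi Z p
  rw [coe_xi, coe_phi] at h1
  rw [coe_xi] at h2
  rw [h, h1, h2, ← coe_phi, ← coe_xi, connection_phi, xi_apply, dphi_ξ hD hS, connection_xi,
    map_sub, phi_apply, nabXi_φ hD hS]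
  module

end Contact

end AlmostParaContactMetric

/-! ### Metric contractions over dual families and their derivatives -/

omit [IsManifold (𝓡 (2 * n + 1)) ∞ M] in
instance finite_tangentSpace (p : M) : Module.Finite ℝ (TangentSpace (𝓡 (2 * n + 1)) p) :=
  inferInstanceAs (Module.Finite ℝ (Model n))

omit [IsManifold (𝓡 (2 * n + 1)) ∞ M] in
lemma finrank_tangentSpace (p : M) :
    Module.finrank ℝ (TangentSpace (𝓡 (2 * n + 1)) p) = 2 * n + 1 :=
  (finrank_euclideanSpace_fin : Module.finrank ℝ (Model n) = 2 * n + 1)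

/-- The families `b` and `c` of tangent vectors at `p` are generating and dual to each other. -/
def PseudoMetric.IsDualAt (g : PseudoMetric n M) {ι : Type*} [Fintype ι] (p : M)
    (b c : ι → TangentSpace (𝓡 (2 * n + 1)) p) : Prop :=
  ∀ x, ∑ i, g.val p (c i) x • b i = x

namespace PseudoMetric.IsDualAt

variable {g : PseudoMetric n M} {ι : Type*} [Fintype ι] {p : M}
  {b c : ι → TangentSpace (𝓡 (2 * n + 1)) p} (hb : g.IsDualAt p b c)

include hb

lemma sum_mul (x y : TangentSpace (𝓡 (2 * n + 1)) p) :
    ∑ i, g.val p (c i) x * g.val p (b i) y = g.val p x y := by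
  conv_rhs => rw [← hb x]
  simp [map_sum]

lemma symm : g.IsDualAt p c b := fun x ↦ by
  refine g.eq_of_forall fun y ↦ ?_
  rw [g.symm p x y, ← hb.sum_mul y x]
  simp [map_sum, mul_comm]

lemma sum_apply_eq_trace
    (T : TangentSpace (𝓡 (2 * n + 1)) p →ₗ[ℝ] TangentSpace (𝓡 (2 * n + 1)) p) :
    ∑ i, g.val p (c i) (T (b i)) = LinearMap.trace ℝ _ T := by
  have e := Module.finBasis ℝ (TangentSpace (𝓡 (2 * n + 1)) p)
  rw [LinearMap.trace_eq_matrix_trace ℝ e, Matrix.trace]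
  simp only [Matrix.diag_apply, LinearMap.toMatrix_apply]
  have h (k) : e.repr (T (e k)) k = ∑ i, g.val p (c i) (e k) * e.repr (T (b i)) k := by
    conv_lhs => rw [← hb (e k)]
    simp [map_sum]
  simp only [h]
  rw [Finset.sum_comm]
  refine Finset.sum_congr rfl fun i _ ↦ ?_
  conv_lhs => rw [← e.sum_repr (T (b i))]
  simp only [map_sum, map_smul, smul_eq_mul, mul_comm]

lemma sum_mul_apply (η : TangentSpace (𝓡 (2 * n + 1)) p →ₗ[ℝ] ℝ)
    (x : TangentSpace (𝓡 (2 * n + 1)) p) :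
    ∑ i, η (b i) * g.val p (c i) x = η x := by
  conv_rhs => rw [← hb x]
  simp [mul_comm]

end PseudoMetric.IsDualAt

omit [IsManifold (𝓡 (2 * n + 1)) ∞ M] in
lemma mvfderiv_sum {ι : Type*} (s : Finset ι) (f : ι → M → ℝ) (p : M)
    (hf : ∀ i ∈ s, MDifferentiableAt (𝓡 (2 * n + 1)) 𝓘(ℝ, ℝ) (f i) p) :
    mvfderiv (𝓡 (2 * n + 1)) (fun q ↦ ∑ i ∈ s, f i q) p
      = ∑ i ∈ s, mvfderiv (𝓡 (2 * n + 1)) (f i) p := by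
  classical
  have key : MDifferentiableAt (𝓡 (2 * n + 1)) 𝓘(ℝ, ℝ) (fun q ↦ ∑ i ∈ s, f i q) p ∧
      mvfderiv (𝓡 (2 * n + 1)) (fun q ↦ ∑ i ∈ s, f i q) p
        = ∑ i ∈ s, mvfderiv (𝓡 (2 * n + 1)) (f i) p := by
    induction s using Finset.induction_on with
    | empty => exact ⟨by simpa using! mdifferentiableAt_const, by simp [mvfderiv_const]⟩
    | insert a s ha ih =>
      obtain ⟨h1, h2⟩ := ih fun i hi ↦ hf i (Finset.mem_insert_of_mem hi)
      have h3 := hf a (Finset.mem_insert_self a s)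
      simp only [Finset.sum_insert ha]
      exact ⟨h3.add h1, by rw [mvfderiv_fun_add h3 h1, h2]⟩
  exact key.2

omit [IsManifold (𝓡 (2 * n + 1)) ∞ M] in
lemma mvfderiv_congr {f f' : M → ℝ} {p : M} (h : ∀ᶠ q in nhds p, f q = f' q) :
    mvfderiv (𝓡 (2 * n + 1)) f p = mvfderiv (𝓡 (2 * n + 1)) f' p := by
  have h' : f =ᶠ[nhds p] f' := h
  simp only [mvfderiv, h'.mfderiv_eq]
  rfl

namespace IsLeviCivita

variable {g : PseudoMetric n M} {D : Connection n M} (hD : IsLeviCivita g D)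
  {ι : Type*} [Fintype ι] {p : M} {b c : ι → SVF n M}
  (hb : ∀ᶠ q in nhds p, g.IsDualAt q (fun i ↦ b i q) (fun i ↦ c i q))

include hD hb in
lemma sum_dual_deriv [T2Space M] (u x : TangentSpace (𝓡 (2 * n + 1)) p) :
    ∑ i, (g.val p (D (c i) p u) x • b i p + g.val p (c i p) x • D (b i) p u) = 0 := by
  refine g.eq_of_forall fun y ↦ ?_
  obtain ⟨X, rfl⟩ := exists_apply_eq x
  obtain ⟨Y, rfl⟩ := exists_apply_eq y
  have h := congrArg (· u) (mvfderiv_congr (hb.mono fun q hq ↦ hq.sum_mul (X q) (Y q)))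
  have hm := fun (X Y : SVF n M) ↦ g.mdifferentiableAt_apply X Y p
  have hmul := fun i ↦ mvfderiv_fun_mul (hm (c i) X) (hm (b i) Y)
  have hs : mvfderiv (𝓡 (2 * n + 1))
      (fun q ↦ ∑ i, g.val q (c i q) (X q) * g.val q (b i q) (Y q)) p
      = ∑ i, mvfderiv (𝓡 (2 * n + 1))
        (fun q ↦ g.val q (c i q) (X q) * g.val q (b i q) (Y q)) p :=
    mvfderiv_sum _ _ _ fun i _ ↦ (hm (c i) X).mul (hm (b i) Y)
  rw [hs] at h
  simp only [hmul, _root_.sum_apply, _root_.add_apply, _root_.smul_apply, smul_eq_mul,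
    hD.mvfderiv_metric] at h
  have h1 := hb.self_of_nhds.sum_mul (D X p u) (Y p)
  have h2 := hb.self_of_nhds.sum_mul (X p) (D Y p u)
  rw [← h1, ← h2, ← Finset.sum_add_distrib, ← sub_eq_zero, ← Finset.sum_sub_distrib] at h
  simp only [map_sum, map_add, map_smul, _root_.sum_apply, _root_.add_apply, _root_.smul_apply,
    smul_eq_mul, map_zero, _root_.zero_apply]
  rw [← h]
  exact Finset.sum_congr rfl fun i _ ↦ by ring

include hD hb in
/-- The metric contraction of an endomorphism is parallel. -/
lemma sum_dual_deriv_apply [T2Space M] (u : TangentSpace (𝓡 (2 * n + 1)) p)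
    (T : TangentSpace (𝓡 (2 * n + 1)) p →ₗ[ℝ] TangentSpace (𝓡 (2 * n + 1)) p) :
    ∑ i, (g.val p (D (c i) p u) (T (b i p)) + g.val p (c i p) (T (D (b i) p u))) = 0 := by
  have hp := hb.self_of_nhds
  -- After both terms are expanded over a second index `j`, the sum over `i` for fixed `j` is `T`
  -- applied to the vanishing vector of `sum_dual_deriv` with `x = c j p`.
  have e1 (i : ι) : g.val p (D (c i) p u) (T (b i p))
      = ∑ j, g.val p (b j p) (T (g.val p (D (c i) p u) (c j p) • b i p)) := by
    have h := hp.symm (T (b i p))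
    conv_lhs => rw [← h]
    simp [map_sum, mul_comm]
  have e2 (i : ι) : g.val p (c i p) (T (D (b i) p u))
      = ∑ j, g.val p (b j p) (T (g.val p (c i p) (c j p) • D (b i) p u)) := by
    have h := hp (c i p)
    conv_lhs => rw [← h]
    simp [map_sum, g.symm p (c i p)]
  simp only [e1, e2, ← Finset.sum_add_distrib, ← map_add]
  rw [Finset.sum_comm]
  refine Finset.sum_eq_zero fun j _ ↦ ?_
  rw [← map_sum, ← map_sum, hD.sum_dual_deriv hb]
  simp

end IsLeviCivita

/-! ### Traces of φ, ∇ξ and ∇φ -/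

namespace AlmostParaContactMetric

variable {ε₀ ε₁ : ℝ} {S : AlmostParaContactMetric n M ε₀ ε₁}
  {D : Connection n M} (hD : IsLeviCivita S.g D)

include hD in
lemma exists_dphi_linearMap [T2Space M] (p : M) (u : TangentSpace (𝓡 (2 * n + 1)) p) :
    ∃ L : TangentSpace (𝓡 (2 * n + 1)) p →ₗ[ℝ] TangentSpace (𝓡 (2 * n + 1)) p,
      ∀ Z, S.dphi D Z p u = L (Z p) := by
  refine exists_linearMap (fun Z ↦ S.dphi D Z p u) (fun X Y ↦ ?_) (fun a X ↦ ?_) fun X hX ↦ ?_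
  · have : S.phi (X + Y) = S.phi X + S.phi Y := by ext; simp
    simp only [dphi, this, connection_add, _root_.sub_apply, _root_.add_apply,
      ContinuousLinearMap.comp_apply, map_add]
    abel
  · have : S.phi (a • X) = a • S.phi X := by ext; simp
    simp only [dphi, this, connection_smul, _root_.sub_apply, _root_.smul_apply,
      ContinuousLinearMap.comp_apply, map_smul]
    module
  · refine S.g.nondegenerate p _ fun w ↦ ?_
    obtain ⟨W, rfl⟩ := exists_apply_eq w
    rw [dphi_skew hD, hX]
    simp

section Trace

variable {ι : Type*} [Fintype ι] {p : M} {b c : ι → TangentSpace (𝓡 (2 * n + 1)) p}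
  (hb : S.g.IsDualAt p b c)

include hb

lemma trace_smulRight_ξ (f : TangentSpace (𝓡 (2 * n + 1)) p →ₗ[ℝ] ℝ) :
    LinearMap.trace ℝ _ (f.smulRight (S.ξ p)) = f (S.ξ p) := by
  rw [← hb.sum_apply_eq_trace, ← hb.sum_mul_apply]
  simp

lemma trace_φ : LinearMap.trace ℝ _ (S.φ p).toLinearMap = 0 := by
  have h1 := hb.sum_apply_eq_trace (S.φ p)
  have h2 := hb.symm.sum_apply_eq_trace (S.φ p)
  simp only [ContinuousLinearMap.coe_coe] at h1 h2
  rw [← Finset.sum_congr rfl fun i _ ↦ S.g.symm p (S.φ p (c i)) (b i),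
    Finset.sum_congr rfl fun i _ ↦ S.g_φ_left p (c i) (b i), Finset.sum_neg_distrib, h1] at h2
  linarith

lemma trace_φ_φ : LinearMap.trace ℝ _
    ((S.φ p).toLinearMap ∘ₗ (S.φ p).toLinearMap)
      = 2 * n * ε₁ := by
  have h : (S.φ p).toLinearMap ∘ₗ (S.φ p).toLinearMap
      = ε₁ • (LinearMap.id - (S.η p).toLinearMap.smulRight (S.ξ p)) := by
    ext u
    simp [S.φ_sq]
  rw [h, map_smul, map_sub, trace_smulRight_ξ hb, LinearMap.trace_id, finrank_tangentSpace]
  simp only [ContinuousLinearMap.coe_coe, S.η_ξ, smul_eq_mul]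
  push_cast
  ring

variable [T2Space M] (hS : S.IsParaContact)

include hD hS

/-- By cyclicity tr(φAφ) = tr(Aφ²); the left side is -ε₁ tr A and the right side ε₁ tr A. -/
lemma trace_nabXi :
    LinearMap.trace ℝ _ (S.nabXi D p).toLinearMap = 0 := by
  set F := (S.φ p).toLinearMap
  set A := (S.nabXi D p).toLinearMap
  have h1 : F ∘ₗ (A ∘ₗ F) = -ε₁ • A - (2 * ε₀ * ε₁) • F := by
    ext u
    exact φ_nabXi_φ hD hS p u
  have h2 : (A ∘ₗ F) ∘ₗ F = ε₁ • A := by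
    ext u
    simp [A, F, S.φ_sq, nabXi_ξ hD hS]
  have h3 := LinearMap.trace_comp_comm' F (A ∘ₗ F)
  rw [h1, h2, map_sub, map_smul, map_smul, map_smul, trace_φ hb] at h3
  simp only [smul_eq_mul] at h3
  refine (mul_eq_zero.1 (?_ : ε₁ * _ = 0)).resolve_left S.sign₁_ne_zero
  linarith

lemma trace_φ_nabXi : LinearMap.trace ℝ _
    ((S.φ p).toLinearMap ∘ₗ (S.nabXi D p).toLinearMap)
      = -(2 * n * ε₀ * ε₁) := by
  set F := (S.φ p).toLinearMap
  set A := (S.nabXi D p).toLinearMap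
  have h1 : A ∘ₗ F = -(F ∘ₗ A) - (2 * ε₀) • (F ∘ₗ F) := by
    ext u
    exact nabXi_φ hD hS p u
  have h3 := LinearMap.trace_comp_comm' F A
  rw [h1, map_sub, map_neg, map_smul, trace_φ_φ hb, smul_eq_mul] at h3
  linarith

/-- Contract closedness with one argument hit by φ: twice the trace equals the trace of (∇_Zφ)φ. The
latter vanishes, since the derivative of φ² makes ∇_Zφ anticommute with φ up to a trace-free term.
-/
lemma trace_φ_dphi (Z : SVF n M) : LinearMap.trace ℝ _
    ((S.φ p).toLinearMap ∘ₗ (S.dphi D Z p).toLinearMap) = 0 := by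
  obtain ⟨L, hL⟩ := exists_dphi_linearMap hD p (Z p)
  choose e he using fun v ↦ exists_apply_eq (M := M) (n := n) (p := p) v
  set F := (S.φ p).toLinearMap
  set P := (S.dphi D Z p).toLinearMap
  have h1 (i : ι) : -S.g.val p (c i) ((F ∘ₗ P) (b i)) - S.g.val p (b i) ((P ∘ₗ F) (c i))
      + S.g.val p (b i) ((L ∘ₗ F) (c i)) = 0 := by
    have h := closed hD hS (e (b i)) (S.phi (e (c i))) Z p
    have h' := dphi_skew hD (e (b i)) Z p (S.φ p (c i))
    rw [S.g.symm, he] at h'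
    rw [hL, phi_apply, he, he, S.g_φ_left, h'] at h
    exact h
  have h2 := Finset.sum_congr rfl fun i (_ : i ∈ Finset.univ) ↦ h1 i
  rw [Finset.sum_add_distrib, Finset.sum_sub_distrib, Finset.sum_neg_distrib,
    hb.sum_apply_eq_trace, hb.symm.sum_apply_eq_trace, hb.symm.sum_apply_eq_trace,
    Finset.sum_const_zero] at h2
  have h3 : L ∘ₗ F + F ∘ₗ L = -ε₁ • ((ε₀ •
      (S.g.val p (S.nabXi D p (Z p))).toLinearMap.smulRight (S.ξ p))
      + (S.η p).toLinearMap.smulRight (S.nabXi D p (Z p))) := by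
    ext v
    have h := dphi_phi hD (e v) p (Z p)
    rw [hL, hL, phi_apply, he] at h
    simp only [LinearMap.add_apply, LinearMap.comp_apply, LinearMap.smul_apply,
      LinearMap.smulRight_apply, ContinuousLinearMap.coe_coe, smul_smul]
    exact h
  have h4 : LinearMap.trace ℝ _ ((S.η p).toLinearMap.smulRight (S.nabXi D p (Z p))) = 0 := by
    rw [← hb.sum_apply_eq_trace]
    have := hb.sum_mul_apply (S.η p) (S.nabXi D p (Z p))
    simp only [ContinuousLinearMap.coe_coe, η_nabXi hD] at this
    simpa using this
  have h5 := congrArg (LinearMap.trace ℝ _) h3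
  rw [map_add, map_smul, map_add, map_smul, h4, trace_smulRight_ξ hb, ContinuousLinearMap.coe_coe,
    S.g_ξ_right, η_nabXi hD, LinearMap.trace_comp_comm' F L] at h5
  rw [LinearMap.trace_comp_comm' F P, LinearMap.trace_comp_comm' F L] at h2
  simp only [mul_zero, smul_zero, add_zero] at h5
  linarith

/-- The divergence of φ. It follows from `trace_φ_dphi` at φZ once φ(∇φ)φ is reduced by `dphi_phi`;
the constant is that of tr(φA). -/
lemma trace_dphi (Z : SVF n M) :
    LinearMap.trace ℝ _ (S.dphi D Z p).toLinearMap
      = 2 * n * ε₀ * ε₁ * S.η p (Z p) := by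
  have h1 := trace_φ_dphi hD hb hS (S.phi Z)
  have h2 := trace_φ_nabXi hD hb hS
  have h3 : (S.φ p).toLinearMap
        ∘ₗ (S.dphi D (S.phi Z) p).toLinearMap
      = -ε₁ • ((S.dphi D Z p).toLinearMap
        - ((S.η p).toLinearMap ∘ₗ (S.dphi D Z p).toLinearMap).smulRight (S.ξ p)
        + S.η p (Z p) • ((S.φ p).toLinearMap
          ∘ₗ (S.nabXi D p).toLinearMap)) := by
    ext u
    have h := eq_sub_of_add_eq (dphi_phi hD Z p u)
    simp only [LinearMap.add_apply, LinearMap.sub_apply, LinearMap.comp_apply,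
      LinearMap.smul_apply, LinearMap.smulRight_apply, ContinuousLinearMap.coe_coe, h, map_sub,
      map_smul, map_add, S.φ_ξ, S.φ_sq]
    module
  rw [h3, map_smul, map_add, map_sub, map_smul, h2, trace_smulRight_ξ hb, LinearMap.comp_apply,
    ContinuousLinearMap.coe_coe, ContinuousLinearMap.coe_coe, dphi_ξ hD hS, map_zero] at h1
  have h4 := (smul_eq_zero.1 h1).resolve_left (neg_ne_zero.2 S.sign₁_ne_zero)
  simp only [smul_eq_mul] at h4
  linarith

end Trace

end AlmostParaContactMetric

/-! ### Local dual frames -/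

omit [IsManifold (𝓡 (2 * n + 1)) ∞ M] in
lemma contMDiff_det {ι : Type*} [Fintype ι] [DecidableEq ι] {A : M → Matrix ι ι ℝ}
    (hA : ∀ i j, ContMDiff (𝓡 (2 * n + 1)) 𝓘(ℝ, ℝ) ∞ fun q ↦ A q i j) :
    ContMDiff (𝓡 (2 * n + 1)) 𝓘(ℝ, ℝ) ∞ fun q ↦ (A q).det := by
  simp only [Matrix.det_apply']
  exact contMDiff_finsetSum fun σ _ ↦
    contMDiff_const.mul (contMDiff_finsetProd fun i _ ↦ hA _ _)

omit [IsManifold (𝓡 (2 * n + 1)) ∞ M] in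
lemma contMDiff_adjugate {ι : Type*} [Fintype ι] [DecidableEq ι] {A : M → Matrix ι ι ℝ}
    (hA : ∀ i j, ContMDiff (𝓡 (2 * n + 1)) 𝓘(ℝ, ℝ) ∞ fun q ↦ A q i j) (i j : ι) :
    ContMDiff (𝓡 (2 * n + 1)) 𝓘(ℝ, ℝ) ∞ fun q ↦ (A q).adjugate i j := by
  simp only [Matrix.adjugate_apply]
  refine contMDiff_det fun k l ↦ ?_
  simp only [Matrix.updateRow_apply]
  split_ifs
  · exact contMDiff_const
  · exact hA k l

/-- A smooth function that does not vanish at `p` has a smooth inverse near `p`. -/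
lemma exists_contMDiff_mul_eq_one [T2Space M] {f : M → ℝ}
    (hf : ContMDiff (𝓡 (2 * n + 1)) 𝓘(ℝ, ℝ) ∞ f) {p : M} (hp : f p ≠ 0) :
    ∃ u : M → ℝ, ContMDiff (𝓡 (2 * n + 1)) 𝓘(ℝ, ℝ) ∞ u ∧ ∀ᶠ q in nhds p, u q * f q = 1 := by
  have hs : {q | f q ≠ 0} ∈ nhds p := hf.continuous.continuousAt.eventually_ne hp
  obtain ⟨ψ, hψ, -⟩ := (SmoothBumpFunction.nhds_basis_support (I := 𝓡 (2 * n + 1)) hs).mem_iff.1 hs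
  refine ⟨fun q ↦ ψ q * (f q)⁻¹, contMDiff_of_tsupport fun x hx ↦ ?_, ?_⟩
  · exact ψ.contMDiff.contMDiffAt.mul
      ((hf x).inv₀ (hψ (tsupport_mul_subset_left hx)))
  · filter_upwards [hs, ψ.eventuallyEq_one] with q hq h1
    rw [h1, Pi.one_apply, one_mul, inv_mul_cancel₀ hq]

lemma PseudoMetric.isDualAt_of_eq_ite (g : PseudoMetric n M) {p : M}
    {b c : Fin (2 * n + 1) → TangentSpace (𝓡 (2 * n + 1)) p}
    (h : ∀ i j, g.val p (c i) (b j) = if i = j then 1 else 0) : g.IsDualAt p b c := by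
  have key (a : Fin (2 * n + 1) → ℝ) (i) : g.val p (c i) (∑ j, a j • b j) = a i := by
    simp [map_sum, h]
  have hli : LinearIndependent ℝ b := Fintype.linearIndependent_iff.2 fun a ha i ↦ by
    rw [← key a i, ha, map_zero]
  intro x
  let e := basisOfLinearIndependentOfCardEqFinrank hli
    (by rw [finrank_tangentSpace, Fintype.card_fin])
  have hx : x = ∑ j, e.repr x j • b j := by
    conv_lhs => rw [← e.sum_repr x]
    simp [e]
  rw [hx]
  simp only [key]

/-- An orthonormal basis at `p` extends to a frame of smooth vector fields with a smooth dual
frame near `p`. -/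
lemma exists_dual_frame [T2Space M] (g : PseudoMetric n M) {p : M}
    {E : Fin (2 * n + 1) → TangentSpace (𝓡 (2 * n + 1)) p} (hE : IsOrthonormalFrameAt g p E) :
    ∃ b c : Fin (2 * n + 1) → SVF n M, (∀ i, b i p = E i) ∧
      (∀ i, c i p = g.val p (E i) (E i) • E i) ∧
      ∀ᶠ q in nhds p, g.IsDualAt q (fun i ↦ b i q) (fun i ↦ c i q) := by
  choose b hb using fun i ↦ exists_apply_eq (n := n) (E i)
  let G (q : M) : Matrix (Fin (2 * n + 1)) (Fin (2 * n + 1)) ℝ :=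
    Matrix.of fun i j ↦ g.val q (b i q) (b j q)
  have hG (i j) : ContMDiff (𝓡 (2 * n + 1)) 𝓘(ℝ, ℝ) ∞ fun q ↦ G q i j := g.contMDiff_apply _ _
  have hsq (i) : g.val p (E i) (E i) * g.val p (E i) (E i) = 1 := by
    rcases hE.1 i with h | h <;> simp [h]
  have hGp : G p = Matrix.diagonal fun i ↦ g.val p (E i) (E i) := by
    ext i j
    by_cases hij : i = j
    · subst hij
      simp [G, hb]
    · simp [G, hb, hij, hE.2 i j hij]
  have hdet : (G p).det ≠ 0 := by
    rw [hGp, Matrix.det_diagonal]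
    exact Finset.prod_ne_zero_iff.2 fun i _ h ↦ by simpa [h] using hsq i
  obtain ⟨u, hu, hu1⟩ := exists_contMDiff_mul_eq_one (contMDiff_det hG) hdet
  -- The extended frame need not stay orthonormal away from `p`. Near `p` the factor `u` is 1/det G,
  -- so the coefficients form the inverse Gram matrix, and they are smooth on all of `M`.
  let c (i : Fin (2 * n + 1)) : SVF n M :=
    ⟨fun q ↦ ∑ j, (u q * (G q).adjugate i j) • b j q, ContMDiff.sum_section fun j _ ↦
      ((hu.mul (contMDiff_adjugate hG i j)).smul_section (b j).contMDiff)⟩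
  have hc (i) (q : M) : c i q = ∑ j, (u q * (G q).adjugate i j) • b j q := rfl
  have hδ : ∀ᶠ q in nhds p, ∀ i k, g.val q (c i q) (b k q) = if i = k then 1 else 0 := by
    filter_upwards [hu1] with q hq i k
    have h1 := congrFun (congrFun (Matrix.adjugate_mul (G q)) i) k
    rw [Matrix.mul_apply, Matrix.smul_apply, smul_eq_mul, Matrix.one_apply] at h1
    rw [hc]
    simp only [map_sum, map_smul, _root_.sum_apply, _root_.smul_apply, smul_eq_mul, mul_assoc]
    rw [← Finset.mul_sum]
    change u q * ∑ j, (G q).adjugate i j * G q j k = _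
    rw [h1, ← mul_assoc, hq, one_mul]
  refine ⟨b, c, hb, fun i ↦ ?_, hδ.mono fun q hq ↦ g.isDualAt_of_eq_ite hq⟩
  refine g.eq_of_forall fun w ↦ ?_
  rw [← (g.isDualAt_of_eq_ite hδ.self_of_nhds) w]
  simp only [map_sum, map_smul]
  refine Finset.sum_congr rfl fun k _ ↦ ?_
  rw [hδ.self_of_nhds, hb, _root_.smul_apply]
  congr 1
  split_ifs with hik
  · subst hik
    exact (hsq i).symm
  · rw [hE.2 i k hik, smul_zero]

/-! ### The Ricci tensor as a metric contraction -/

namespace IsLeviCivita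

variable {g : PseudoMetric n M} {D : Connection n M} (hD : IsLeviCivita g D)

/-- The trace uses `extend`, which is guaranteed to be smooth only near `p`; locality of the
curvature allows its replacement by a global smooth field. -/
lemma curv_congr {p : M} {Z : VF n M} {Z' : SVF n M} (h : ∀ᶠ q in nhds p, Z q = Z' q)
    (X Y : SVF n M) : curv D Z X Y p = hD.curvS Z' X Y p := by
  rw [← hD.curv_eq]
  have h1 : ∀ᶠ q in nhds p, cov D Z Y q = hD.nab Z' Y q := by
    filter_upwards [h] with q hq
    rw [cov, hq, nab_apply]
  have h2 : MDifferentiableAt (𝓡 (2 * n + 1)) (𝓡 (2 * n + 1)).tangent (T% (cov D Z Y)) p :=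
    ((hD.nab Z' Y).mdifferentiableAt p).congr_of_eventuallyEq
      (h1.mono fun q hq ↦ congrArg (TotalSpace.mk' (Model n) q) hq)
  have h3 : D (cov D Z Y) p = D (hD.nab Z' Y) p :=
    D.isCovariantDerivativeOnUniv.congr_of_eventuallyEq h2 ((hD.nab Z' Y).mdifferentiableAt p)
      Filter.univ_mem h1
  have h4 : mlieBracket (𝓡 (2 * n + 1)) Z X p = mlieBracket (𝓡 (2 * n + 1)) Z' X p :=
    Filter.EventuallyEq.mlieBracket_vectorField_eq h (Filter.EventuallyEq.refl _ _)
  have h5 : cov D X (cov D Z Y) p = cov D X (cov D Z' Y) p := by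
    change D (cov D Z Y) p (X p) = _
    rw [h3]
    rfl
  have h6 : cov D (mlieBracket (𝓡 (2 * n + 1)) Z X) Y p
      = cov D (mlieBracket (𝓡 (2 * n + 1)) Z' X) Y p := by
    change D Y p _ = D Y p _
    rw [h4]
  have h7 : cov D Z (cov D X Y) p = cov D Z' (cov D X Y) p := by
    change D (cov D X Y) p _ = D (cov D X Y) p _
    rw [h.self_of_nhds]
  rw [curv, curv, h5, h6, h7]

variable [T2Space M] {ι : Type*} [Fintype ι] {p : M} {b c : ι → SVF n M}
  (hp : g.IsDualAt p (fun i ↦ b i p) (fun i ↦ c i p))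

omit [T2Space M] in
lemma traceAt_eq_trace (A : VF n M → VF n M) (p : M)
    (T : TangentSpace (𝓡 (2 * n + 1)) p →ₗ[ℝ] TangentSpace (𝓡 (2 * n + 1)) p)
    (h : ∀ v : TangentSpace (𝓡 (2 * n + 1)) p, A (extend (Model n) v) p = T v) :
    traceAt A p = LinearMap.trace ℝ _ T := by
  rw [LinearMap.trace_eq_matrix_trace ℝ (Module.finBasis ℝ (TangentSpace (𝓡 (2 * n + 1)) p)),
    Matrix.trace]
  simp only [traceAt, h, Matrix.diag_apply, LinearMap.toMatrix_apply]
  rfl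

include hD hp

lemma ric_eq_sum (X Y : SVF n M) :
    Ric D X Y p = ∑ i, g.val p (c i p) (hD.curvS (b i) X Y p) := by
  obtain ⟨L, hL⟩ := hD.exists_curvS_linearMap X Y p
  simp only [hL, hp.sum_apply_eq_trace]
  refine traceAt_eq_trace _ _ _ fun v ↦ ?_
  obtain ⟨V, hV⟩ := exists_eventuallyEq_extend v
  rw [hD.curv_congr (hV.mono fun q hq ↦ hq.symm), hL, hV.self_of_nhds, extend_apply_self]

lemma ric_symm (X Y : SVF n M) : Ric D X Y p = Ric D Y X p := by
  rw [hD.ric_eq_sum hp, hD.ric_eq_sum hp]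
  obtain ⟨L, hL⟩ := hD.exists_curvS_linearMap Y X p
  have h (i : ι) : g.val p (c i p) (hD.curvS (b i) X Y p) = g.val p (b i p) (L (c i p)) := by
    rw [g.symm, hD.metric_curvS_pair, hD.curvS_swap, map_neg, _root_.neg_apply,
      hD.metric_curvS_skew, neg_neg, hL]
  simp only [h, hL, hp.sum_apply_eq_trace]
  exact hp.symm.sum_apply_eq_trace L

end IsLeviCivita

/-! ### Second covariant derivatives of φ and ξ -/

namespace AlmostParaContactMetric

variable {ε₀ ε₁ : ℝ} {S : AlmostParaContactMetric n M ε₀ ε₁}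
  {D : Connection n M} (hD : IsLeviCivita S.g D)

lemma ricci_identity (W X Z : SVF n M) (p : M) :
    hessPhi hD W X Z p - hessPhi hD X W Z p
      = hD.curvS W X (S.phi Z) p - S.φ p (hD.curvS W X Z p) := by
  simp only [hessPhi, IsLeviCivita.curvS, dphiS, SVF.sub_apply, IsLeviCivita.nab_apply,
    connection_sub, _root_.sub_apply, map_sub, phi_apply]
  abel

lemma hessXi_sub (X Y : SVF n M) (p : M) :
    hessXi hD X Y p - hessXi hD Y X p = hD.curvS X Y S.xi p := by
  simp only [hessXi, IsLeviCivita.curvS, SVF.sub_apply, IsLeviCivita.nab_apply, map_sub]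
  abel

lemma nab_dphiS (W X Z : SVF n M) (p : M) :
    D ⇑(dphiS hD X Z) p (W p) = hessPhi hD W X Z p + S.dphi D Z p (D X p (W p))
      + S.dphi D (hD.nab W Z) p (X p) := by
  simp only [hessPhi, SVF.sub_apply, IsLeviCivita.nab_apply, dphiS_apply]
  abel

lemma nab_nabXi (W X : SVF n M) (p : M) :
    D ⇑(hD.nab X S.xi) p (W p) = hessXi hD W X p + S.nabXi D p (D X p (W p)) := by
  simp [hessXi]

lemma dphi_add (X Y : SVF n M) (p : M) : S.dphi D (X + Y) p = S.dphi D X p + S.dphi D Y p := by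
  have : S.phi (X + Y) = S.phi X + S.phi Y := by ext; simp
  ext u
  simp only [dphi, this, connection_add, _root_.sub_apply, _root_.add_apply,
    ContinuousLinearMap.comp_apply, map_add]
  abel

lemma hessPhi_skew (W X Y Z : SVF n M) (p : M) :
    S.g.val p (hessPhi hD W X Y p) (Z p) = -S.g.val p (Y p) (hessPhi hD W X Z p) := by
  have h : (fun q ↦ S.g.val q (dphiS hD X Y q) (Z q))
      = fun q ↦ S.g.val q ((-Y) q) (dphiS hD X Z q) := by
    funext q
    simp [dphi_skew hD]
  have h1 := hD.mvfderiv_metric (dphiS hD X Y) Z p (W p)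
  rw [h, hD.mvfderiv_metric] at h1
  have e1 := dphi_skew hD Y Z p (D X p (W p))
  have e2 := dphi_skew hD Y (hD.nab W Z) p (X p)
  have e3 := dphi_skew hD (hD.nab W Y) Z p (X p)
  simp only [connection_neg, nab_dphiS, _root_.neg_apply, SVF.neg_apply, map_neg, map_add,
    _root_.add_apply, dphiS_apply, IsLeviCivita.nab_apply] at h1 e1 e2 e3
  linarith

/-- The second covariant derivative of φ² = ε₁(1 - η⊗ξ), obtained by differentiating `dphi_phi` and
removing its first-order instances. -/
lemma hessPhi_phi (W X Z : SVF n M) (p : M) :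
    hessPhi hD W X (S.phi Z) p + S.φ p (hessPhi hD W X Z p)
      + S.dphi D (dphiS hD X Z) p (W p) + S.dphi D (dphiS hD W Z) p (X p)
      = -ε₁ • ((ε₀ * S.g.val p (hessXi hD W X p) (Z p)) • S.ξ p
          + (ε₀ * S.g.val p (S.nabXi D p (X p)) (Z p)) • S.nabXi D p (W p)
          + (ε₀ * S.g.val p (S.nabXi D p (W p)) (Z p)) • S.nabXi D p (X p)
          + S.η p (Z p) • hessXi hD W X p) := by
  have h : dphiS hD X (S.phi Z) + S.phi (dphiS hD X Z)
      = -ε₁ • (S.xi.fsmul _ (S.g.contMDiff_apply (ε₀ • hD.nab X S.xi) Z)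
        + (hD.nab X S.xi).fsmul _ (S.contMDiff_η Z)) := by
    ext q
    simpa using dphi_phi hD Z q (X q)
  have h1 := congrArg (fun V : SVF n M ↦ D V p (W p)) h
  simp only [connection_add, connection_smul, connection_fsmul, _root_.add_apply,
    _root_.smul_apply, mvfderiv_η hD, hD.mvfderiv_metric] at h1
  simp only [connection_phi, nab_dphiS, nab_nabXi, _root_.smul_apply, map_add, _root_.add_apply, SVF.smul_apply, IsLeviCivita.nab_apply, connection_xi, xi_apply, map_smul,
    smul_eq_mul] at h1
  have h2 : hD.nab W (S.phi Z) = dphiS hD W Z + S.phi (hD.nab W Z) := by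
    ext q
    simp [connection_phi]
  have e1 := dphi_phi hD Z p (D X p (W p))
  have e2 := dphi_phi hD (hD.nab W Z) p (X p)
  rw [h2, dphi_add, _root_.add_apply] at h1
  rw [IsLeviCivita.nab_apply] at e2
  linear_combination (norm := module) h1 - e1 - e2

section Contact

variable [T2Space M] (hS : S.IsParaContact)

include hS

lemma hessPhi_closed (W X Y Z : SVF n M) (p : M) :
    S.g.val p (Y p) (hessPhi hD W X Z p) + S.g.val p (Z p) (hessPhi hD W Y X p)
      + S.g.val p (X p) (hessPhi hD W Z Y p) = 0 := by
  have h : (fun q ↦ S.g.val q (Y q) (dphiS hD X Z q) + S.g.val q (Z q) (dphiS hD Y X q))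
      = fun q ↦ S.g.val q ((-X) q) (dphiS hD Z Y q) := by
    funext q
    have := closed hD hS X Y Z q
    simp only [dphiS_apply, SVF.neg_apply, map_neg, _root_.neg_apply]
    linarith
  have h1 := congrArg (fun f ↦ mvfderiv (𝓡 (2 * n + 1)) f p (W p)) h
  simp only [mvfderiv_fun_add (S.g.mdifferentiableAt_apply _ _ _)
    (S.g.mdifferentiableAt_apply _ _ _), _root_.add_apply, hD.mvfderiv_metric] at h1
  simp only [connection_neg, nab_dphiS, SVF.neg_apply, map_neg, map_add, _root_.neg_apply, dphiS_apply] at h1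
  have c1 := closed hD hS (hD.nab W X) Y Z p
  have c2 := closed hD hS X (hD.nab W Y) Z p
  have c3 := closed hD hS X Y (hD.nab W Z) p
  simp only [IsLeviCivita.nab_apply] at c1 c2 c3
  linarith

variable {ι : Type*} [Fintype ι] {p : M} {b c : ι → SVF n M}
  (hb : ∀ᶠ q in nhds p, S.g.IsDualAt q (fun i ↦ b i q) (fun i ↦ c i q))

include hb

/-- The derivative along W of the divergence formula `trace_dphi`; contraction commutes with ∇ by
`sum_dual_deriv_apply`. -/
lemma sum_hessPhi (W Z : SVF n M) :
    ∑ i, S.g.val p (c i p) (hessPhi hD W (b i) Z p)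
      = 2 * n * ε₁ * S.g.val p (S.nabXi D p (W p)) (Z p) := by
  have hp := hb.self_of_nhds
  have hm := fun (X Y : SVF n M) ↦ S.g.mdifferentiableAt_apply X Y p
  have h1 : ∀ᶠ q in nhds p, ∑ i, S.g.val q (c i q) (dphiS hD (b i) Z q)
      = S.g.val q (((2 * n * ε₁) • S.xi) q) (Z q) := by
    filter_upwards [hb] with q hq
    have h := hq.sum_apply_eq_trace (S.dphi D Z q).toLinearMap
    rw [trace_dphi hD hq hS] at h
    simp only [ContinuousLinearMap.coe_coe] at h
    simp only [dphiS_apply, h, SVF.smul_apply, map_smul, _root_.smul_apply, xi_apply, smul_eq_mul,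
      S.g_ξ_left]
    ring
  have h2 := congrArg (· (W p)) (mvfderiv_congr h1)
  rw [mvfderiv_sum _ (fun i q ↦ S.g.val q (c i q) (dphiS hD (b i) Z q)) _
    fun i _ ↦ hm (c i) _] at h2
  simp only [_root_.sum_apply, hD.mvfderiv_metric] at h2
  simp only [nab_dphiS, map_add, connection_smul,
    _root_.smul_apply, SVF.smul_apply, map_smul, smul_eq_mul, connection_xi, xi_apply,
    S.g_ξ_left, dphiS_apply, Finset.sum_add_distrib] at h2
  have h3 := hp.sum_apply_eq_trace (S.dphi D (hD.nab W Z) p).toLinearMap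
  rw [trace_dphi hD hp hS] at h3
  have h4 := hD.sum_dual_deriv_apply hb (W p) (S.dphi D Z p).toLinearMap
  simp only [ContinuousLinearMap.coe_coe, Finset.sum_add_distrib, IsLeviCivita.nab_apply] at h3 h4
  linarith

lemma sum_hessXi (W : SVF n M) : ∑ i, S.g.val p (c i p) (hessXi hD W (b i) p) = 0 := by
  have hm := fun (X Y : SVF n M) ↦ S.g.mdifferentiableAt_apply X Y p
  have h1 : ∀ᶠ q in nhds p, ∑ i, S.g.val q (c i q) (hD.nab (b i) S.xi q) = 0 := by
    filter_upwards [hb] with q hq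
    have h := hq.sum_apply_eq_trace (S.nabXi D q).toLinearMap
    rwa [trace_nabXi hD hq hS] at h
  have h2 := congrArg (· (W p)) (mvfderiv_congr h1)
  rw [mvfderiv_sum _ (fun i q ↦ S.g.val q (c i q) (hD.nab (b i) S.xi q)) _
    fun i _ ↦ hm (c i) _, mvfderiv_const] at h2
  simp only [_root_.sum_apply, hD.mvfderiv_metric] at h2
  simp only [nab_nabXi, map_add, Finset.sum_add_distrib,
    IsLeviCivita.nab_apply, connection_xi, _root_.zero_apply] at h2
  have h4 := hD.sum_dual_deriv_apply hb (W p) (S.nabXi D p).toLinearMap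
  simp only [ContinuousLinearMap.coe_coe, Finset.sum_add_distrib] at h4
  linarith

/-- The rough Laplacian of ξ: trace `dcontact`, exchange the two derivatives at the cost of a Ricci
term, and use that div ξ = 0 has zero derivative. -/
lemma sum_hessXi_diag (Z : SVF n M) :
    ∑ i, S.g.val p (hessXi hD (b i) (c i) p) (Z p)
      = Ric D Z S.xi p + 4 * n * ε₁ * S.η p (Z p) := by
  have hp := hb.self_of_nhds
  have h1 (i : ι) := dcontact hD hS (b i) (c i) Z p
  have h2 (i : ι) : S.g.val p (hessXi hD (b i) Z p) (c i p)
      = S.g.val p (c i p) (hessXi hD Z (b i) p) + S.g.val p (c i p) (hD.curvS (b i) Z S.xi p) := by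
    rw [S.g.symm, ← map_add, ← hessXi_sub]
    simp
  have h3 := Finset.sum_congr rfl fun i (_ : i ∈ Finset.univ) ↦ h1 i
  simp only [h2] at h3
  rw [← Finset.mul_sum, ← Finset.mul_sum, Finset.sum_sub_distrib, Finset.sum_add_distrib,
    sum_hessXi hD hS hb, ← hD.ric_eq_sum hp] at h3
  have h4 := hp.sum_apply_eq_trace (S.dphi D Z p).toLinearMap
  rw [trace_dphi hD hp hS] at h4
  simp only [ContinuousLinearMap.coe_coe] at h4
  rw [h4] at h3
  linear_combination (-ε₀) * h3 + (4 * n * ε₁ * S.η p (Z p) + Ric D Z S.xi p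
    - ∑ i, S.g.val p (hessXi hD (b i) (c i) p) (Z p)) * S.sign₀_mul_self

end Contact

end AlmostParaContactMetric

/-! ### Contractions giving Ric and Ric* -/

namespace AlmostParaContactMetric

variable {ε₀ ε₁ : ℝ} {S : AlmostParaContactMetric n M ε₀ ε₁}
  {D : Connection n M} (hD : IsLeviCivita S.g D) [T2Space M]

section Ricci

variable {ι : Type*} [Fintype ι] {p : M} {b c : ι → SVF n M}
  (hp : S.g.IsDualAt p (fun i ↦ b i p) (fun i ↦ c i p))

include hD

lemma ricStar_eq_trace (X Y : SVF n M)
    (L : TangentSpace (𝓡 (2 * n + 1)) p →ₗ[ℝ] TangentSpace (𝓡 (2 * n + 1)) p)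
    (hL : ∀ Z, hD.curvS Z X (S.phi Y) p = L (Z p)) :
    S.RicStar D X Y p = LinearMap.trace ℝ _ (L ∘ₗ (S.φ p).toLinearMap) := by
  refine IsLeviCivita.traceAt_eq_trace _ _ _ fun v ↦ ?_
  obtain ⟨V, hV⟩ := exists_eventuallyEq_extend v
  have h : ∀ᶠ q in nhds p, S.φF (extend (Model n) v) q = S.phi V q := by
    filter_upwards [hV] with q hq
    rw [φF, ← hq, phi_apply]
  rw [← coe_phi, hD.curv_congr h, hL, phi_apply, hV.self_of_nhds, extend_apply_self]
  rfl

include hp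

lemma sum_curvS_phi_right (X Y : SVF n M) :
    ∑ i, S.g.val p (S.φ p (c i p)) (hD.curvS (b i) X (S.phi Y) p) = -S.RicStar D X Y p := by
  obtain ⟨L, hL⟩ := hD.exists_curvS_linearMap X (S.phi Y) p
  rw [ricStar_eq_trace hD X Y L hL, LinearMap.trace_comp_comm', ← hp.sum_apply_eq_trace,
    ← Finset.sum_neg_distrib]
  refine Finset.sum_congr rfl fun i _ ↦ ?_
  rw [S.g_φ_left, hL]
  rfl

/-- Pair symmetry exchanges the roles of the dual families and brings φY to the last slot, as in the
definition of Ric*. -/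
lemma sum_curvS_phi_mid (X Y : SVF n M) :
    ∑ i, S.g.val p (S.φ p (c i p)) (hD.curvS (b i) (S.phi Y) X p) = S.RicStar D X Y p := by
  obtain ⟨L, hL⟩ := hD.exists_curvS_linearMap X (S.phi Y) p
  rw [ricStar_eq_trace hD X Y L hL, ← hp.symm.sum_apply_eq_trace]
  refine Finset.sum_congr rfl fun i _ ↦ ?_
  have h := hD.metric_curvS_pair (b i) (S.phi Y) X (S.phi (c i)) p
  rw [hD.curvS_swap X, map_neg, _root_.neg_apply, hD.metric_curvS_skew (S.phi (c i)) X (b i),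
    neg_neg, hL] at h
  rw [S.g.symm, ← phi_apply, h]
  rfl

lemma ric_phi_phi (X Y : SVF n M) :
    Ric D X (S.phi (S.phi Y)) p = ε₁ * (Ric D X Y p - S.η p (Y p) * Ric D X S.xi p) := by
  rw [hD.ric_eq_sum hp, hD.ric_eq_sum hp, hD.ric_eq_sum hp, Finset.mul_sum,
    ← Finset.sum_sub_distrib, Finset.mul_sum]
  refine Finset.sum_congr rfl fun i _ ↦ ?_
  have h (Z : SVF n M) : S.g.val p (c i p) (hD.curvS (b i) X Z p)
      = -S.g.val p (hD.curvS (b i) X (c i) p) (Z p) := by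
    rw [hD.metric_curvS_skew, neg_neg]
  simp only [h, phi_apply, S.φ_sq, map_smul, map_sub, smul_eq_mul, xi_apply]
  ring

end Ricci

/-! ### The rough Laplacian of φ in two ways -/

variable (hS : S.IsParaContact)

section Laplacian

variable {ι : Type*} [Fintype ι] {p : M} {b c : ι → SVF n M}
  (hb : ∀ᶠ q in nhds p, S.g.IsDualAt q (fun i ↦ b i q) (fun i ↦ c i q))

include hS hb

lemma sum_hessPhi_left (Y Z : SVF n M) :
    ∑ i, S.g.val p (c i p) (hessPhi hD (b i) Y Z p)
      = 2 * n * ε₁ * S.g.val p (S.nabXi D p (Y p)) (Z p) + Ric D Y (S.phi Z) p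
        + ∑ i, S.g.val p (S.φ p (c i p)) (hD.curvS (b i) Y Z p) := by
  rw [← sum_hessPhi hD hS hb, hD.ric_eq_sum hb.self_of_nhds, ← Finset.sum_add_distrib,
    ← Finset.sum_add_distrib]
  refine Finset.sum_congr rfl fun i _ ↦ ?_
  have h := congrArg (S.g.val p (c i p)) (ricci_identity hD (b i) Y Z p)
  rw [map_sub, map_sub] at h
  rw [S.g_φ_left]
  linarith

omit hb in
/-- The rough Laplacian of the fundamental form. -/
lemma sum_hessPhi_diag (Y Z : SVF n M) :
    ∑ i, S.g.val p (Y p) (hessPhi hD (b i) (c i) Z p)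
      = ∑ i, S.g.val p (c i p) (hessPhi hD (b i) Y Z p)
        - ∑ i, S.g.val p (c i p) (hessPhi hD (b i) Z Y p) := by
  rw [← Finset.sum_sub_distrib]
  refine Finset.sum_congr rfl fun i _ ↦ ?_
  have h1 := hessPhi_closed hD hS (b i) (c i) Y Z p
  have h2 := hessPhi_skew hD (b i) Y (c i) Z p
  rw [S.g.symm] at h2
  linarith

/-- Pair `hessPhi_phi` with Y. Skewness of φ and ∇²φ moves φ from outside the second derivative onto
Y, giving the symmetric partner, and skewness of ∇φ turns the iterated first derivatives into
products. -/
lemma sum_hessPhi_diag_phi (Y Z : SVF n M) :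
    ∑ i, S.g.val p (Y p) (hessPhi hD (b i) (c i) (S.phi Z) p)
        + ∑ i, S.g.val p (Z p) (hessPhi hD (b i) (c i) (S.phi Y) p)
      = ∑ i, S.g.val p (S.dphi D Y p (b i p)) (S.dphi D Z p (c i p))
        + ∑ i, S.g.val p (S.dphi D Y p (c i p)) (S.dphi D Z p (b i p))
        - ε₁ * (S.η p (Y p) * (Ric D Z S.xi p + 4 * n * ε₁ * S.η p (Z p))
          + S.η p (Z p) * (Ric D Y S.xi p + 4 * n * ε₁ * S.η p (Y p))
          + ε₀ * ∑ i, S.g.val p (S.nabXi D p (c i p)) (Z p) * S.g.val p (S.nabXi D p (b i p)) (Y p)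
          + ε₀ * ∑ i, S.g.val p (S.nabXi D p (c i p)) (Y p)
            * S.g.val p (S.nabXi D p (b i p)) (Z p)) := by
  rw [← sum_hessXi_diag hD hS hb, ← sum_hessXi_diag hD hS hb]
  simp only [Finset.mul_sum, ← Finset.sum_add_distrib, ← Finset.sum_sub_distrib]
  refine Finset.sum_congr rfl fun i _ ↦ ?_
  have h := congrArg (S.g.val p (Y p)) (hessPhi_phi hD (b i) (c i) Z p)
  have h1 := hessPhi_skew hD (b i) (c i) Z (S.phi Y) p
  have h2 := dphi_skew hD (dphiS hD (c i) Z) Y p (b i p)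
  have h3 := dphi_skew hD (dphiS hD (b i) Z) Y p (c i p)
  rw [S.g.symm] at h1 h2 h3
  rw [phi_apply, S.g_φ_left] at h1
  rw [S.g.symm, dphiS_apply] at h2 h3
  simp only [map_add, map_smul, smul_eq_mul, S.g_ξ_right] at h
  rw [S.g.symm p (Y p) (hessXi hD (b i) (c i) p), S.g.symm p (Y p) (S.nabXi D p (b i p)),
    S.g.symm p (Y p) (S.nabXi D p (c i p))] at h
  have e1 := S.g.symm p (dphiS hD (c i) Z p) (S.dphi D Y p (b i p))
  have e2 := S.g.symm p (dphiS hD (b i) Z p) (S.dphi D Y p (c i p))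
  have s2 := S.g.symm p (Y p) (S.dphi D (dphiS hD (c i) Z) p (b i p))
  have s3 := S.g.symm p (Y p) (S.dphi D (dphiS hD (b i) Z) p (c i p))
  simp only [dphiS_apply] at *
  linear_combination h + h1 - s2 - s3 - h2 - h3 + e1 + e2
    - ε₁ * S.η p (Y p) * S.g.val p (hessXi hD (b i) (c i) p) (Z p) * S.sign₀_mul_self

end Laplacian

end AlmostParaContactMetric

/-! ### The quadratic terms in ∇ξ and the final identity -/

namespace AlmostParaContactMetric

variable {ε₀ ε₁ : ℝ} {S : AlmostParaContactMetric n M ε₀ ε₁}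
  {D : Connection n M} (hD : IsLeviCivita S.g D) [T2Space M] (hS : S.IsParaContact)

include hD hS

lemma g_h_left (Y Z : SVF n M) (p : M) :
    S.g.val p (S.h Y p) (Z p) = S.g.val p (Y p) (S.h Z p) := by
  have h := g_nabXi hD hS p (Y p) (S.φ p (Z p))
  rw [nabXi_φ hD hS] at h
  simp only [h_eq hD hS, map_add, map_smul, _root_.add_apply, _root_.smul_apply, S.g_φ_left,
    h, smul_eq_mul, map_sub, map_neg]
  ring

lemma nabXi_add_eq (Z : SVF n M) (p : M) :
    S.nabXi D p (Z p) + (2 * ε₀) • S.φ p (Z p) = S.φ p (ε₁ • S.h Z p + ε₀ • Z p) := by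
  rw [h_eq hD hS]
  simp only [map_add, map_smul, map_sub, S.φ_sq, η_nabXi hD, zero_smul, sub_zero, S.φ_ξ,
    smul_zero]
  match_scalars
  · linear_combination -S.sign₁_mul_self
  · linear_combination -ε₀ * S.sign₁_mul_self

/-- The contraction is g(A*Z, A*Y) for the adjoint A* = A + 2ε₀φ = φ(ε₁h + ε₀), and compatibility of
g with φ evaluates it. -/
lemma sum_g_nabXi {ι : Type*} [Fintype ι] {p : M}
    {b c : ι → TangentSpace (𝓡 (2 * n + 1)) p} (hp : S.g.IsDualAt p b c) (Y Z : SVF n M) :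
    ∑ i, S.g.val p (S.nabXi D p (c i)) (Z p) * S.g.val p (S.nabXi D p (b i)) (Y p)
      = -ε₁ * (S.g.val p (S.h Y p) (S.h Z p) + 2 * ε₀ * ε₁ * S.g.val p (Y p) (S.h Z p)
        + S.g.val p (Y p) (Z p) - ε₀ * S.η p (Y p) * S.η p (Z p)) := by
  have hη (Z : SVF n M) : S.η p (S.h Z p) = 0 := by simp [h_eq hD hS]
  simp only [g_nabXi hD hS]
  rw [hp.sum_mul, nabXi_add_eq hD hS, nabXi_add_eq hD hS, S.g_φ]
  simp only [map_add, map_smul, _root_.add_apply, _root_.smul_apply, smul_eq_mul, hη]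
  rw [← g_h_left hD hS Z Y, S.g.symm p (S.h Z p) (S.h Y p), S.g.symm p (S.h Z p) (Y p),
    S.g.symm p (Z p)]
  linear_combination (-ε₁ * S.g.val p (S.h Y p) (S.h Z p)) * S.sign₁_mul_self
    - ε₁ * (S.g.val p (Y p) (Z p) - ε₀ * S.η p (Y p) * S.η p (Z p)) * S.sign₀_mul_self

lemma g_nabXi_φ_sub (p : M) (u v : TangentSpace (𝓡 (2 * n + 1)) p) :
    S.g.val p (S.nabXi D p u) (S.φ p v) - S.g.val p (S.nabXi D p (S.φ p v)) u
      = 2 * ε₁ * (ε₀ * S.g.val p u v - S.η p u * S.η p v) := by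
  have h := contact hD hS p u (S.φ p v)
  simp only [S.φ_sq, map_smul, map_sub, smul_eq_mul, S.g_ξ_right] at h
  linear_combination -ε₀ * h - (S.g.val p (S.nabXi D p u) (S.φ p v)
    - S.g.val p (S.nabXi D p (S.φ p v)) u + 2 * ε₁ * S.η p u * S.η p v) * S.sign₀_mul_self

theorem ric_identity {ι : Type*} [Fintype ι] {p : M} {b c : ι → SVF n M}
    (hb : ∀ᶠ q in nhds p, S.g.IsDualAt q (fun i ↦ b i q) (fun i ↦ c i q)) (Y Z : SVF n M) :
    2 * (Ric D (S.phi Y) (S.phi Z) p - ε₁ * Ric D Y Z p + S.RicStar D Y Z p + S.RicStar D Z Y p)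
      = -(∑ i, S.g.val p (S.dphi D Y p (b i p)) (S.dphi D Z p (c i p)))
        - ∑ i, S.g.val p (S.dphi D Y p (c i p)) (S.dphi D Z p (b i p))
        + 2 * ((4 * n - 1) * ε₀ * S.g.val p (Y p) (Z p) + S.η p (Y p) * S.η p (Z p)
          - 2 * ε₁ * S.g.val p (Y p) (S.h Z p) - ε₀ * S.g.val p (S.h Y p) (S.h Z p)) := by
  have hp := hb.self_of_nhds
  have key := sum_hessPhi_diag_phi hD hS hb Y Z
  have a1 := sum_g_nabXi hD hS hp Y Z
  have a2 := sum_g_nabXi hD hS hp Z Y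
  have c1 := g_nabXi_φ_sub hD hS p (Y p) (Z p)
  have c2 := g_nabXi_φ_sub hD hS p (Z p) (Y p)
  rw [← g_h_left hD hS, S.g.symm p _ (Y p), S.g.symm p _ (Y p),
    S.g.symm p (S.h Z p) (S.h Y p)] at a2
  rw [S.g.symm p (Z p)] at c2
  rw [sum_hessPhi_diag hD hS, sum_hessPhi_diag hD hS] at key
  simp only [sum_hessPhi_left hD hS hb, sum_curvS_phi_right hD hp, sum_curvS_phi_mid hD hp,
    ric_phi_phi hD hp, hD.ric_symm hp (S.phi Z), hD.ric_symm hp Z Y, phi_apply, a1, a2] at key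
  -- The Ric(·,ξ) terms cancel here; `c1` and `c2` evaluate the divergence terms, and the remaining
  -- summands only apply ε₀² = ε₁² = 1.
  linear_combination -key + 2 * n * ε₁ * (c1 + c2)
    - ε₁ ^ 2 * (4 * ε₁ * S.g.val p (Y p) (S.h Z p) - 2 * S.η p (Y p) * S.η p (Z p))
        * S.sign₀_mul_self
    + (8 * n * ε₀ * S.g.val p (Y p) (Z p)
      - 2 * ε₀ * (S.g.val p (S.h Y p) (S.h Z p) + S.g.val p (Y p) (Z p))
      - 4 * ε₁ * S.g.val p (Y p) (S.h Z p) + 2 * S.η p (Y p) * S.η p (Z p)) * S.sign₁_mul_self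

/-- The curvature identity in an orthonormal frame. -/
theorem ric_identity_of_orthonormal {p : M}
    {E : Fin (2 * n + 1) → TangentSpace (𝓡 (2 * n + 1)) p} (hE : IsOrthonormalFrameAt S.g p E)
    (X Y : SVF n M) :
    Ric D (S.phi X) (S.phi Y) p - ε₁ * Ric D X Y p + S.RicStar D X Y p + S.RicStar D Y X p
      = -(∑ i, S.g.val p (E i) (E i) * S.g.val p (S.covφ D (E i) X) (S.covφ D (E i) Y))
        + (4 * n - 1) * ε₀ * S.g.val p (X p) (Y p) + S.η p (X p) * S.η p (Y p)
        - 2 * ε₁ * S.g.val p (X p) (S.h Y p) - ε₀ * S.g.val p (S.h X p) (S.h Y p) := by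
  obtain ⟨b, c, hb, hc, hbc⟩ := exists_dual_frame S.g hE
  have h := ric_identity hD hS hbc X Y
  -- At `p` one has c_i = ε_i E_i, so the two mixed sums coincide and the common factor 2 drops out.
  simp only [hb, hc, map_smul, _root_.smul_apply, smul_eq_mul, ← covφ_eq] at h
  linarith

end AlmostParaContactMetric

end ParaContact

end

theorem mainTheorem6 (n : ℕ) (M : Type*) [TopologicalSpace M] [T2Space M]
    [SecondCountableTopology M] [ChartedSpace (ParaContact.Model n) M]
    [IsManifold (𝓡 (2 * n + 1)) ∞ M] (ε₀ ε₁ : ℝ)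
    (S : ParaContact.AlmostParaContactMetric n M ε₀ ε₁) (hS : S.IsParaContact)
    (D : ParaContact.Connection n M) (hD : ParaContact.IsLeviCivita S.g D)
    (X Y : ParaContact.VF n M) (hX : ParaContact.SmoothVF X) (hY : ParaContact.SmoothVF Y)
    (p : M) (E : Fin (2 * n + 1) → TangentSpace (𝓡 (2 * n + 1)) p)
    (hE : ParaContact.IsOrthonormalFrameAt S.g p E) :
    ParaContact.Ric D (S.φF X) (S.φF Y) p - ε₁ * ParaContact.Ric D X Y p
        + S.RicStar D X Y p + S.RicStar D Y X p
      = -(∑ i, S.g.val p (E i) (E i) * S.g.val p (S.covφ D (E i) X) (S.covφ D (E i) Y))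
        + (4 * (n : ℝ) - 1) * ε₀ * S.g.val p (X p) (Y p)
        + S.η p (X p) * S.η p (Y p)
        - 2 * ε₁ * S.g.val p (X p) (S.h Y p)
        - ε₀ * S.g.val p (S.h X p) (S.h Y p) := by
  exact ParaContact.AlmostParaContactMetric.ric_identity_of_orthonormal hD hS hE ⟨X, hX⟩ ⟨Y, hY⟩
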